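/- Let $G$ be a countable discrete group, let $d_k\ge 1$ be integers, and let $\sigma_k\colon G\to S_{d_k}$ be a sofic approximation: writing $u_n(A)=|A|/n$ for $A\subseteq\{1,\dots,n\}$, we have $u_{d_k}(\{j:\sigma_k(gh)(j)=\sigma_k(g)\sigma_k(h)(j)\})\to 1$ as $k\to\infty$ for all $g,h\in G$ and $u_{d_k}(\{j:\sigma_k(g)(j)\ne\sigma_k(h)(j)\})\to 1$ for all $g\neq h$. Let $\omega$ be a free ultrafilter on $\mathbb N$, and let $G\curvearrowright X$ be an algebraic action, i.e. an action by continuous automorphisms of a compact metrizable group $X$. **Notation.** $Z_\omega=\prod_k\{1,\dots,d_k\}/\!\sim$, where $(j_k)\sim(j_k')$ iff $\{k:j_k=j'_k\}\in\omega$. It carries the $\sigma$-algebra generated by the internal sets $\prod_{k\to\omega}A_k=\{[(j_k)]:\{k:j_k\in A_k\}\in\omega\}$, $A_k\subseteq\{1,\dots,d_k\}$, and the Loeb measure $u_\omega$, the probability measure on it with $u_\omega(\prod_{k\to\omega}A_k)=\lim_{k\to\omega}u_{d_k}(A_k)$. For $g\in G$ put $g[(j_k)]=[(\sigma_k(g)(j_k))]$.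 $\mathrm{Meas}(Z_\omega,T)$ is the set of measurable maps $Z_\omega\to T$ modulo $u_\omega$-a.e. equality. $\mathrm{Sub}(X)$ is the space of closed subgroups of $X$ with the topology of the Hausdorff metric, and $\mathrm{Meas}(Z_\omega,\mathrm{Sub}(X))$ is ordered by $Y_1\le Y_2$ iff $Y_1(z)\subseteq Y_2(z)$ for a.e. $z$. $\mathrm{Prob}(\cdot)$ denotes Borel probability measures with the weak$^*$ topology, $m_H\in\mathrm{Prob}(X)$ is the Haar probability measure of $H\in\mathrm{Sub}(X)$, and $m_Y(z)=m_{Y(z)}$ for $Y\in\mathrm{Meas}(Z_\omega,\mathrm{Sub}(X))$. For $\mu_k\in\mathrm{Prob}(X^{d_k})$ let $\mu_{k,j}$ be the $j$-th marginal of $\mu_k$. * $(\mu_k)$ is *asymptotically supported on topological microstates* as $k\to\omega$ if for every $g\in G$, every open neighbourhood $U$ of the diagonal of $X\times X$ and every $\varepsilon>0$, $$\lim_{k\to\omega}\mu_k\bigl(\{\phi: u_{d_k}(\{j:(\phi(\sigma_k(g)(j)),g\phi(j))\in U\})>1-\varepsilon\}\bigr)=1.$$ * $(\mu_k)$ *locally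 weak$^*$ converges* to $\mu\in\mathrm{Prob}(X)$ as $k\to\omega$ if $\lim_{k\to\omega}u_{d_k}(\{j:\mu_{k,j}\in O\})=1$ for every weak$^*$ neighbourhood $O$ of $\mu$. * $\mathcal L_\omega$ is the set of all $m\in\mathrm{Meas}(Z_\omega,\mathrm{Prob}(X))$ of the form $m([(j_k)])=\lim_{k\to\omega}\mu_{k,j_k}$ (a.e.) for some $(\mu_k)$ asymptotically supported on topological microstates as $k\to\omega$ (the *generalized local weak$^*$ limits* of such sequences). Put $\mathcal S_\omega=\{Y\in\mathrm{Meas}(Z_\omega,\mathrm{Sub}(X)):m_Y\in\mathcal L_\omega\}$. * $Y\in\mathrm{Meas}(Z_\omega,\mathrm{Sub}(X))$ *absorbs all topological microstates* if every $\Theta\in\mathrm{Meas}(Z_\omega,X)$ with $\Theta(gz)=g\Theta(z)$ for a.e. $z$, for each $g\in G$, satisfies $\Theta(z)\in Y(z)$ for a.e. $z$. **Theorem 1.2.** 1. $\mathcal S_\omega$ has a maximal (that is, greatest) element $Y$: $Y\in\mathcal S_\omega$ and $Y'\le Y$ for all $Y'\in\mathcal S_\omega$. 2. If $Y$ is as in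 1, then $Y$ is also the minimal (that is, least) element of $\mathrm{Meas}(Z_\omega,\mathrm{Sub}(X))$ which absorbs all topological microstates. 3. If $Y$ is as in 1, then $Y=X$ (i.e. $Y(z)=X$ for a.e. $z$) if and only if there are $\mu_k\in\mathrm{Prob}(X^{d_k})$ which are asymptotically supported on topological microstates and locally weak$^*$ converge to $m_X$ as $k\to\omega$. -/

import Mathlib

open MeasureTheory Filter Topology
open scoped ENNReal

namespace SoficLoeb

/-! ### Uniform measures, sofic approximations -/

/-- The uniform probability `u_n(A) = |A| / n` of a subset `A` of an `n`-element set. -/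
noncomputable def unif {n : ℕ} (A : Set (Fin n)) : ℝ :=
  (A.ncard : ℝ) / n

/-- A sofic approximation of `G`: maps `σ k : G → Sym(d k)` (not assumed to be homomorphisms) which
are asymptotically multiplicative and asymptotically free in the normalized Hamming distance. -/
structure IsSoficApproximation {G : Type*} [Group G] {d : ℕ → ℕ}
    (σ : ∀ k, G → Equiv.Perm (Fin (d k))) : Prop where
  mul : ∀ g h : G,
    Tendsto (fun k => unif {j | σ k (g * h) j = σ k g (σ k h j)}) atTop (𝓝 1)
  free : ∀ g h : G, g ≠ h →
    Tendsto (fun k => unif {j | σ k g j ≠ σ k h j}) atTop (𝓝 1)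

/-! ### The Loeb measure space -/

/-- The ultraproduct of the finite sets `{1, …, d k}` along `ω`. -/
def LoebSpace (ω : Ultrafilter ℕ) (d : ℕ → ℕ) : Type :=
  Filter.Product (ω : Filter ℕ) (fun k => Fin (d k))

section Loeb

variable {ω : Ultrafilter ℕ} {d : ℕ → ℕ}

/-- The class in the ultraproduct of a sequence of points. -/
def LoebSpace.mk (ω : Ultrafilter ℕ) (d : ℕ → ℕ) (j : ∀ k, Fin (d k)) : LoebSpace ω d :=
  Quotient.mk (Filter.productSetoid (ω : Filter ℕ) fun k => Fin (d k)) j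

theorem LoebSpace.mk_eq_mk {i j : ∀ k, Fin (d k)} :
    LoebSpace.mk ω d i = LoebSpace.mk ω d j ↔ ∀ᶠ k in (ω : Filter ℕ), i k = j k :=
  Quotient.eq (r := Filter.productSetoid (ω : Filter ℕ) fun k => Fin (d k))

theorem LoebSpace.exists_rep (z : LoebSpace ω d) : ∃ j, LoebSpace.mk ω d j = z :=
  Quotient.exists_rep z

/-- The internal subset `∏_{k → ω} A k` of the ultraproduct. -/
def internalSet (ω : Ultrafilter ℕ) {d : ℕ → ℕ} (A : ∀ k, Set (Fin (d k))) :
    Set (LoebSpace ω d) :=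
  {z | ∃ j, LoebSpace.mk ω d j = z ∧ ∀ᶠ k in (ω : Filter ℕ), j k ∈ A k}

/-- The σ-algebra generated by the internal sets. -/
instance LoebSpace.instMeasurableSpace : MeasurableSpace (LoebSpace ω d) :=
  MeasurableSpace.generateFrom (Set.range (internalSet ω))

/-- The limit `lim_{k → ω} |A k| / d k`, as an extended nonnegative real number. -/
noncomputable def limUnif (ω : Ultrafilter ℕ) (A : ∀ k, Set (Fin (d k))) : ℝ≥0∞ :=
  limUnder (ω : Filter ℕ) (fun k => ENNReal.ofReal (unif (A k)))

theorem mk_mem_internalSet {A : ∀ k, Set (Fin (d k))} {j : ∀ k, Fin (d k)} :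
    LoebSpace.mk ω d j ∈ internalSet ω A ↔ ∀ᶠ k in (ω : Filter ℕ), j k ∈ A k := by
  constructor
  · rintro ⟨i, hi, h⟩
    filter_upwards [LoebSpace.mk_eq_mk.1 hi, h] with k h1 h2
    exact h1 ▸ h2
  · exact fun h => ⟨j, rfl, h⟩

theorem tendsto_limUnif (A : ∀ k, Set (Fin (d k))) :
    Tendsto (fun k => ENNReal.ofReal (unif (A k))) (ω : Filter ℕ) (𝓝 (limUnif ω A)) := by
  obtain ⟨x, -, hx⟩ := isCompact_univ.ultrafilter_le_nhds
    (ω.map fun k => ENNReal.ofReal (unif (A k))) (by simp)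
  exact tendsto_nhds_limUnder ⟨x, hx⟩

theorem unif_nonneg {n : ℕ} (A : Set (Fin n)) : 0 ≤ unif A := by
  unfold unif; positivity

theorem unif_mono {n : ℕ} {A B : Set (Fin n)} (h : A ⊆ B) : unif A ≤ unif B := by
  unfold unif
  gcongr
  exact Set.toFinite B

theorem unif_union_le {n : ℕ} (A B : Set (Fin n)) : unif (A ∪ B) ≤ unif A + unif B := by
  unfold unif
  rw [← add_div]
  gcongr
  exact_mod_cast Set.ncard_union_le A B

theorem limUnif_mono {A B : ∀ k, Set (Fin (d k))}
    (h : ∀ᶠ k in (ω : Filter ℕ), A k ⊆ B k) : limUnif ω A ≤ limUnif ω B :=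
  le_of_tendsto_of_tendsto (tendsto_limUnif A) (tendsto_limUnif B)
    (h.mono fun _ hk => ENNReal.ofReal_le_ofReal (unif_mono hk))

theorem limUnif_empty : limUnif ω (fun k => (∅ : Set (Fin (d k)))) = 0 := by
  refine tendsto_nhds_unique (tendsto_limUnif _) ?_
  simp [unif]

theorem limUnif_union_le (A B : ∀ k, Set (Fin (d k))) :
    limUnif ω (fun k => A k ∪ B k) ≤ limUnif ω A + limUnif ω B := by
  refine le_of_tendsto_of_tendsto (tendsto_limUnif _)
    ((tendsto_limUnif A).add (tendsto_limUnif B)) (Eventually.of_forall fun k => ?_)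
  simp only
  rw [← ENNReal.ofReal_add (unif_nonneg _) (unif_nonneg _)]
  exact ENNReal.ofReal_le_ofReal (unif_union_le _ _)

theorem limUnif_inter_add_diff (A B : ∀ k, Set (Fin (d k))) :
    limUnif ω (fun k => A k ∩ B k) + limUnif ω (fun k => A k \ B k) = limUnif ω A := by
  refine tendsto_nhds_unique ((tendsto_limUnif _).add (tendsto_limUnif _)) ?_
  refine (tendsto_limUnif A).congr fun k => ?_
  rw [← ENNReal.ofReal_add (unif_nonneg _) (unif_nonneg _)]
  congr 1
  unfold unif
  rw [← add_div, ← Nat.cast_add, Set.ncard_inter_add_ncard_sdiff_eq_ncard _ _ (Set.toFinite _)]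

/-- The infimum of the limiting densities of the internal sets containing `S`. -/
noncomputable def loebContent (ω : Ultrafilter ℕ) (d : ℕ → ℕ) (S : Set (LoebSpace ω d)) : ℝ≥0∞ :=
  ⨅ (A : ∀ k, Set (Fin (d k))) (_ : S ⊆ internalSet ω A), limUnif ω A

theorem loebContent_empty : loebContent ω d ∅ = 0 :=
  le_antisymm ((iInf₂_le (fun _ => (∅ : Set _)) (Set.empty_subset _)).trans_eq limUnif_empty) bot_le

/-- The Loeb outer measure. -/
noncomputable def loebOuter (ω : Ultrafilter ℕ) (d : ℕ → ℕ) : OuterMeasure (LoebSpace ω d) :=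
  OuterMeasure.ofFunction (loebContent ω d) loebContent_empty

theorem le_caratheodory_loebOuter :
    (LoebSpace.instMeasurableSpace : MeasurableSpace (LoebSpace ω d)) ≤
      (loebOuter ω d).caratheodory := by
  refine MeasurableSpace.generateFrom_le ?_
  rintro _ ⟨B, rfl⟩
  refine OuterMeasure.ofFunction_caratheodory fun t => le_iInf₂ fun A hA => ?_
  rw [← limUnif_inter_add_diff A B]
  refine add_le_add (iInf₂_le _ ?_) (iInf₂_le _ ?_)
  · rintro z ⟨hz, hzB⟩
    obtain ⟨j, rfl⟩ := z.exists_rep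
    exact mk_mem_internalSet.2
      ((mk_mem_internalSet.1 (hA hz)).and (mk_mem_internalSet.1 hzB))
  · rintro z ⟨hz, hzB⟩
    obtain ⟨j, rfl⟩ := z.exists_rep
    rw [mk_mem_internalSet, ← Ultrafilter.eventually_not] at hzB
    exact mk_mem_internalSet.2 ((mk_mem_internalSet.1 (hA hz)).and hzB)

/-- The Loeb measure `u_ω`: the Carathéodory extension, to the σ-algebra generated by the internal
sets, of `∏_{k → ω} A k ↦ lim_{k → ω} |A k| / d k`. -/
noncomputable def loebMeasure (ω : Ultrafilter ℕ) (d : ℕ → ℕ) : Measure (LoebSpace ω d) :=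
  (loebOuter ω d).toMeasure le_caratheodory_loebOuter

/-- Countable covers of internal sets by internal sets have finite subcovers. -/
theorem exists_finite_subcover [∀ k, NeZero (d k)] (hω : ∀ s : Set ℕ, s.Finite → s ∉ ω)
    (A : ∀ k, Set (Fin (d k))) (B : ℕ → ∀ k, Set (Fin (d k)))
    (h : internalSet ω A ⊆ ⋃ n, internalSet ω (B n)) :
    ∃ N, ∀ᶠ k in (ω : Filter ℕ), A k ⊆ ⋃ n ∈ Finset.range N, B n k := by
  classical
  by_contra hcon
  let P : ℕ → ℕ → Prop := fun k N => ¬ A k ⊆ ⋃ n ∈ Finset.range N, B n k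
  have hP : ∀ N, ∀ᶠ k in (ω : Filter ℕ), P k N :=
    fun N => Ultrafilter.eventually_not.2 fun hN => hcon ⟨N, hN⟩
  let M : ℕ → ℕ := fun k => Nat.findGreatest (P k) k
  have key : ∀ k, ∃ j : Fin (d k), P k 0 → j ∈ A k ∧ ∀ n < M k, j ∉ B n k := by
    intro k
    by_cases h0 : P k 0
    · have hM : P k (M k) := Nat.findGreatest_spec (P := P k) (Nat.zero_le k) h0
      obtain ⟨j, hjA, hjB⟩ := Set.not_subset.1 hM
      refine ⟨j, fun _ => ⟨hjA, fun n hn hj => hjB ?_⟩⟩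
      exact Set.mem_biUnion (by simpa using hn) hj
    · exact ⟨0, fun h => absurd h h0⟩
  choose j hj using key
  obtain ⟨n, hn⟩ := Set.mem_iUnion.1
    (h (mk_mem_internalSet.2 ((hP 0).mono fun k hk => (hj k hk).1)))
  have hlt : ∀ᶠ k in (ω : Filter ℕ), n + 1 ≤ k := by
    by_contra hc
    rw [← Ultrafilter.eventually_not] at hc
    exact hω _ ((Set.finite_lt_nat (n + 1)).subset fun k hk => by simpa using hk) hc
  obtain ⟨k, h1, h2, h3, h4⟩ :=
    ((mk_mem_internalSet.1 hn).and (hlt.and ((hP 0).and (hP (n + 1))))).exists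
  exact (hj k h3).2 n (Nat.le_findGreatest (P := P k) h2 h4) h1

theorem limUnif_biUnion_le (B : ℕ → ∀ k, Set (Fin (d k))) (N : ℕ) :
    limUnif ω (fun k => ⋃ n ∈ Finset.range N, B n k) ≤
      ∑ n ∈ Finset.range N, limUnif ω (B n) := by
  induction N with
  | zero => simp [limUnif_empty]
  | succ N ih =>
    rw [Finset.sum_range_succ]
    refine le_trans (limUnif_mono (Eventually.of_forall fun k => ?_))
      ((limUnif_union_le (fun k => ⋃ n ∈ Finset.range N, B n k) (B N)).trans (by gcongr))
    rw [Finset.range_add_one, Finset.set_biUnion_insert, Set.union_comm]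

/-- The defining property of the Loeb measure. -/
theorem loebMeasure_internalSet [∀ k, NeZero (d k)] (hω : ∀ s : Set ℕ, s.Finite → s ∉ ω)
    (A : ∀ k, Set (Fin (d k))) :
    loebMeasure ω d (internalSet ω A) = limUnif ω A := by
  have hmeas : MeasurableSet (internalSet ω A) :=
    MeasurableSpace.measurableSet_generateFrom (Set.mem_range_self A)
  rw [loebMeasure, toMeasure_apply _ _ hmeas]
  refine le_antisymm ((OuterMeasure.ofFunction_le _).trans (iInf₂_le A (Set.Subset.refl _))) ?_
  rw [loebOuter, OuterMeasure.ofFunction_apply]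
  refine le_iInf₂ fun t ht => ENNReal.le_of_forall_pos_le_add fun ε hε hfin => ?_
  obtain ⟨δ, hδ, hsum⟩ := ENNReal.exists_pos_sum_of_countable
    (ENNReal.coe_ne_zero.2 hε.ne') ℕ
  have hB : ∀ n, ∃ B : ∀ k, Set (Fin (d k)),
      t n ⊆ internalSet ω B ∧ limUnif ω B ≤ loebContent ω d (t n) + δ n := by
    intro n
    have hne : loebContent ω d (t n) ≠ ∞ := (ENNReal.lt_top_of_tsum_ne_top hfin.ne n).ne
    have hlt := ENNReal.lt_add_right hne (ENNReal.coe_ne_zero.2 (hδ n).ne')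
    obtain ⟨B, hB⟩ := iInf_lt_iff.1 hlt
    obtain ⟨hsub, hB⟩ := iInf_lt_iff.1 hB
    exact ⟨B, hsub, hB.le⟩
  choose B hBs hB using hB
  obtain ⟨N, hN⟩ := exists_finite_subcover hω A B (ht.trans (Set.iUnion_mono hBs))
  calc limUnif ω A ≤ ∑ n ∈ Finset.range N, limUnif ω (B n) :=
        (limUnif_mono hN).trans (limUnif_biUnion_le B N)
    _ ≤ ∑ n ∈ Finset.range N, (loebContent ω d (t n) + δ n) := by gcongr with n; exact hB n
    _ ≤ ∑' n, (loebContent ω d (t n) + δ n) := ENNReal.sum_le_tsum _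
    _ = ∑' n, loebContent ω d (t n) + ∑' n, (δ n : ℝ≥0∞) := ENNReal.tsum_add
    _ ≤ _ := by gcongr

/-- The function `(f k)_{k → ω}` on the ultraproduct: `[(j k)] ↦ lim_{k → ω} f k (j k)`. It is used
for compact Hausdorff targets, where this limit always exists and is unique. -/
noncomputable def ultralimit {T : Type*} [TopologicalSpace T] [Nonempty T] (ω : Ultrafilter ℕ)
    {d : ℕ → ℕ} (f : ∀ k, Fin (d k) → T) : LoebSpace ω d → T :=
  Quotient.lift (fun j : ∀ k, Fin (d k) => limUnder (ω : Filter ℕ) (fun k => f k (j k)))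
    fun i j (h : ∀ᶠ k in (ω : Filter ℕ), i k = j k) =>
      congrArg lim (Filter.map_congr (h.mono fun k hk => congrArg (f k) hk))

/-- The transformation `[(j k)] ↦ [(p k (j k))]` of the ultraproduct given by permutations `p k`. -/
def permAct (ω : Ultrafilter ℕ) {d : ℕ → ℕ} (p : ∀ k, Equiv.Perm (Fin (d k))) :
    LoebSpace ω d → LoebSpace ω d :=
  Quotient.map' (fun j k => p k (j k))
    fun i j (h : ∀ᶠ k in (ω : Filter ℕ), i k = j k) => h.mono fun k hk => congrArg (p k) hk

end Loeb

/-! ### Haar measures and the space of closed subgroups -/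

section Haar

variable {X : Type*} [Group X] [TopologicalSpace X] [IsTopologicalGroup X] [CompactSpace X]

/-- The space `Sub(X)` of closed subgroups of a compact group carries the topology of the Hausdorff
metric (the Vietoris topology) on nonempty closed subsets. -/
instance instTopologicalSpaceClosedSubgroup : TopologicalSpace (ClosedSubgroup X) :=
  TopologicalSpace.induced
    (fun H => (⟨⟨(H : Set X), H.isClosed'.isCompact⟩, ⟨1, H.one_mem⟩⟩ :
      TopologicalSpace.NonemptyCompacts X))
    inferInstance

/-- `X` as a closed subgroup of itself. -/
def wholeGroup (X : Type*) [Group X] [TopologicalSpace X] : ClosedSubgroup X :=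
  ⟨⊤, isClosed_univ⟩

variable [MeasurableSpace X] [BorelSpace X]

/-- The Haar probability measure `m_X` of a compact group. -/
noncomputable def haarProb (X : Type*) [Group X] [TopologicalSpace X] [IsTopologicalGroup X]
    [CompactSpace X] [MeasurableSpace X] [BorelSpace X] : ProbabilityMeasure X :=
  ⟨Measure.haarMeasure ⊤, ⟨by
    simpa using Measure.haarMeasure_self (K₀ := (⊤ : TopologicalSpace.PositiveCompacts X))⟩⟩

/-- The Haar probability measure `m_H` of a closed subgroup `H`, as a probability measure on `X`. -/
noncomputable def subgroupHaar (H : ClosedSubgroup X) : ProbabilityMeasure X :=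
  haveI : CompactSpace H.toSubgroup := isCompact_iff_compactSpace.mp H.isClosed'.isCompact
  (haarProb H.toSubgroup).map (f := ((↑) : H.toSubgroup → X)) measurable_subtype_coe.aemeasurable

end Haar

/-! ### Microstates and local weak* limits -/

section Microstates

variable {G : Type*} [Group G] {X : Type*} [TopologicalSpace X] [MeasurableSpace X]
  {d : ℕ → ℕ}

/-- The `j`-th marginal of a probability measure on `X ^ n`. -/
noncomputable def marginal {n : ℕ} (μ : ProbabilityMeasure (Fin n → X)) (j : Fin n) :
    ProbabilityMeasure X :=
  μ.map (f := fun φ => φ j) (measurable_pi_apply j).aemeasurable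

/-- `μ k` is asymptotically supported on topological microstates as `k → ω`: for every `g`, every
open neighbourhood `U` of the diagonal and every `ε > 0`, the `μ k`-probability that
`(φ (σ k g j), g φ(j)) ∈ U` for a proportion more than `1 - ε` of the `j` tends to one. -/
def AsympSupportedOnMicrostates [MulAction G X] (σ : ∀ k, G → Equiv.Perm (Fin (d k)))
    (ω : Ultrafilter ℕ) (μ : ∀ k, ProbabilityMeasure (Fin (d k) → X)) : Prop :=
  ∀ (g : G) (U : Set (X × X)), IsOpen U → Set.diagonal X ⊆ U → ∀ ε : ℝ, 0 < ε →
    Tendsto (fun k => (μ k : Measure (Fin (d k) → X))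
      {φ | 1 - ε < unif {j | (φ (σ k g j), g • φ j) ∈ U}}) (ω : Filter ℕ) (𝓝 1)

/-- `μ k` locally weak* converges to `ν` as `k → ω`. -/
def LocalWeakStarTendsto [OpensMeasurableSpace X]
    (ω : Ultrafilter ℕ) (μ : ∀ k, ProbabilityMeasure (Fin (d k) → X))
    (ν : ProbabilityMeasure X) : Prop :=
  ∀ O ∈ 𝓝 ν, Tendsto (fun k => unif {j | marginal (μ k) j ∈ O}) (ω : Filter ℕ) (𝓝 1)

/-- `m : Z_ω → Prob(X)` is (up to null sets) a generalized local weak* limit of measures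
asymptotically supported on topological microstates, i.e. it belongs to `L_ω(G ↷ X)`. -/
def IsGeneralizedLocalLimit [MulAction G X] [OpensMeasurableSpace X] [Nonempty X]
    (σ : ∀ k, G → Equiv.Perm (Fin (d k))) (ω : Ultrafilter ℕ)
    (m : LoebSpace ω d → ProbabilityMeasure X) : Prop :=
  ∃ μ : ∀ k, ProbabilityMeasure (Fin (d k) → X), AsympSupportedOnMicrostates σ ω μ ∧
    haveI : Nonempty (ProbabilityMeasure X) := ⟨diracProba (Classical.arbitrary X)⟩
    m =ᵐ[loebMeasure ω d] ultralimit ω (fun k => marginal (μ k))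

/-- A topological microstate: a measurable map `Θ : Z_ω → X` (up to null sets) which is almost
surely `G`-equivariant. -/
def IsMicrostate [MulAction G X] (σ : ∀ k, G → Equiv.Perm (Fin (d k))) (ω : Ultrafilter ℕ)
    (Θ : LoebSpace ω d →ₘ[loebMeasure ω d] X) : Prop :=
  ∀ g : G, ∀ᵐ z ∂(loebMeasure ω d), Θ (permAct ω (fun k => σ k g) z) = g • Θ z

/-- The set-valued map `Y` on `Z_ω` absorbs all topological microstates. -/
def AbsorbsMicrostates [MulAction G X] (σ : ∀ k, G → Equiv.Perm (Fin (d k)))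
    (ω : Ultrafilter ℕ) (Y : LoebSpace ω d → Set X) : Prop :=
  ∀ Θ : LoebSpace ω d →ₘ[loebMeasure ω d] X, IsMicrostate σ ω Θ →
    ∀ᵐ z ∂(loebMeasure ω d), Θ z ∈ Y z

end Microstates

section Algebraic

variable {G : Type*} [Group G] (X : Type*) [Group X] [TopologicalSpace X] [IsTopologicalGroup X]
  [CompactSpace X] {d : ℕ → ℕ}

/-- `Meas(Z_ω, Sub(X))`: measurable maps from the Loeb space to `Sub(X)` modulo almost everywhere
equality, with the order `Y₁ ≤ Y₂` iff `Y₁ z ⊆ Y₂ z` for almost every `z`. -/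
abbrev MeasSub (ω : Ultrafilter ℕ) (d : ℕ → ℕ) : Type _ :=
  LoebSpace ω d →ₘ[loebMeasure ω d] ClosedSubgroup X

/-- `S_ω(G ↷ X)`: those `Y ∈ Meas(Z_ω, Sub(X))` for which `m_Y` is a generalized local weak* limit
of measures asymptotically supported on topological microstates. -/
def localLimitSubgroups [MeasurableSpace X] [BorelSpace X] [MulAction G X]
    (σ : ∀ k, G → Equiv.Perm (Fin (d k))) (ω : Ultrafilter ℕ) : Set (MeasSub X ω d) :=
  {Y | IsGeneralizedLocalLimit σ ω (fun z => subgroupHaar (Y z))}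

/-- Those `Y ∈ Meas(Z_ω, Sub(X))` which absorb all topological microstates. -/
def absorbingSubgroups [MulAction G X]
    (σ : ∀ k, G → Equiv.Perm (Fin (d k))) (ω : Ultrafilter ℕ) : Set (MeasSub X ω d) :=
  {Y | AbsorbsMicrostates σ ω (fun z => (Y z : Set X))}

end Algebraic

end SoficLoeb

/-! Since $G$ acts by automorphisms, the measurable equivariant maps $Z_\omega\to X$ form a group
under pointwise multiplication (`microstateGroup`). There are countably many of them whose values
are a.e. dense among the values of any given one (`exists_countable_ae_mem_closure`). Let $Y_0(z)$
be the closed subgroup generated by their values at $z$. The proof rests on two facts.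

First, $Y_0\in\mathcal S_\omega$ (`isGeneralizedLocalLimit_closedRange`). Let $\Gamma$ be the free
group on the chosen microstates, so that each $\gamma\in\Gamma$ gives a microstate, and draw
$\gamma$ from a Cesàro average of convolution powers of a measure charging every element of
$\Gamma$. At each $z$ the law of the random value converges to the Haar measure of $Y_0(z)$
(`tendsto_map_convAverage`). Lifting every microstate to the finite sets turns this random
microstate into measures on $X^{d_k}$, and a diagonal sequence (`IsLift.exists_diagonal`) realizes
the limit.

Second, every member of $\mathcal S_\omega$ lies below every absorbing $Y'$. If measures supported
on microstates kept a positive average distance from $Y'$, one could select from them a single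
microstate at positive average distance from $Y'$ (`AsympSupportedOnMicrostates.exists_mem`),
contradicting absorption. So the local limit gives $Y'(z)$ mass one
(`AbsorbsMicrostates.ae_measure_eq_one`), and a Haar measure carried by a closed set forces its
subgroup into that set.

As $Y_0$ is absorbing by density and lies in $\mathcal S_\omega$, it is both greatest in $\mathcal
S_\omega$ and least among the absorbing maps. Finally, the constant map $X$ is the top element, so
$Y_0=X$ exactly when $X\in\mathcal S_\omega$; for a constant limit this is local weak* convergence
(`isLift_const_iff`). -/

namespace SoficLoeb

/-! ### Internal sets, limiting densities and permutations of the Loeb space -/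

section LoebBasics

variable {ω : Ultrafilter ℕ} {d : ℕ → ℕ}

theorem measurableSet_internalSet (A : ∀ k, Set (Fin (d k))) :
    MeasurableSet (internalSet ω A) :=
  MeasurableSpace.measurableSet_generateFrom (Set.mem_range_self A)

theorem internalSet_univ : internalSet ω (fun k => (Set.univ : Set (Fin (d k)))) = Set.univ := by
  ext z
  obtain ⟨j, rfl⟩ := z.exists_rep
  simp [mk_mem_internalSet]

theorem internalSet_empty : internalSet ω (fun k => (∅ : Set (Fin (d k)))) = ∅ := by
  ext z
  obtain ⟨j, rfl⟩ := z.exists_rep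
  rw [mk_mem_internalSet]
  simpa using! ω.neBot.ne

theorem internalSet_inter (A B : ∀ k, Set (Fin (d k))) :
    internalSet ω (fun k => A k ∩ B k) = internalSet ω A ∩ internalSet ω B := by
  ext z
  obtain ⟨j, rfl⟩ := z.exists_rep
  simp [mk_mem_internalSet, Set.mem_inter_iff, eventually_and]

theorem internalSet_compl (A : ∀ k, Set (Fin (d k))) :
    internalSet ω (fun k => (A k)ᶜ) = (internalSet ω A)ᶜ := by
  ext z
  obtain ⟨j, rfl⟩ := z.exists_rep
  rw [Set.mem_compl_iff, mk_mem_internalSet, mk_mem_internalSet, ← Ultrafilter.eventually_not]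
  rfl

theorem unif_le_one {n : ℕ} (A : Set (Fin n)) : unif A ≤ 1 := by
  unfold unif
  refine div_le_one_of_le₀ ?_ (Nat.cast_nonneg _)
  have := Set.ncard_le_card A
  simpa using this

theorem unif_univ {n : ℕ} [NeZero n] : unif (Set.univ : Set (Fin n)) = 1 := by
  simp [unif, NeZero.ne]

theorem unif_compl {n : ℕ} [NeZero n] (A : Set (Fin n)) : unif Aᶜ = 1 - unif A := by
  have h := Set.ncard_add_ncard_compl A
  have hn : (n : ℝ) ≠ 0 := by exact_mod_cast NeZero.ne n
  unfold unif
  rw [eq_sub_iff_add_eq, ← add_div, div_eq_one_iff_eq hn]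
  rw [Nat.card_eq_fintype_card, Fintype.card_fin] at h
  exact_mod_cast (by omega : Aᶜ.ncard + A.ncard = n)

theorem unif_preimage_perm {n : ℕ} (p : Equiv.Perm (Fin n)) (A : Set (Fin n)) :
    unif (p ⁻¹' A) = unif A := by
  unfold unif
  congr 2
  rw [← Equiv.image_symm_eq_preimage, Set.ncard_image_of_injective _ p.symm.injective]

theorem limUnif_eq_ofReal {A : ∀ k, Set (Fin (d k))} {x : ℝ}
    (h : Tendsto (fun k => unif (A k)) (ω : Filter ℕ) (𝓝 x)) :
    limUnif ω A = ENNReal.ofReal x :=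
  tendsto_nhds_unique (tendsto_limUnif A) (ENNReal.tendsto_ofReal h)

theorem limUnif_eq_one_iff {A : ∀ k, Set (Fin (d k))} :
    limUnif ω A = 1 ↔ Tendsto (fun k => unif (A k)) (ω : Filter ℕ) (𝓝 1) := by
  refine ⟨fun h => ?_, fun h => by simpa using limUnif_eq_ofReal h⟩
  have h1 := (ENNReal.tendsto_toReal (by simp [h])).comp (tendsto_limUnif (ω := ω) A)
  simpa [Function.comp_def, h, ENNReal.toReal_ofReal (unif_nonneg _)] using h1

theorem eventually_ge_of_free (hω : ∀ s : Set ℕ, s.Finite → s ∉ ω) (n : ℕ) :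
    ∀ᶠ k in (ω : Filter ℕ), n ≤ k := by
  by_contra hc
  rw [← Ultrafilter.eventually_not] at hc
  exact hω _ ((Set.finite_lt_nat n).subset fun k hk => by simpa using hk) hc

/-- A countable saturation principle: properties of arbitrarily high finite level can be
realized along a sequence of levels tending to infinity. -/
theorem exists_tendsto_level (hω : ∀ s : Set ℕ, s.Finite → s ∉ ω) {R : ℕ → ℕ → Prop}
    (hR : ∀ n, ∀ᶠ k in (ω : Filter ℕ), R n k) :
    ∃ n : ℕ → ℕ, Tendsto n (ω : Filter ℕ) atTop ∧ ∀ᶠ k in (ω : Filter ℕ), R (n k) k := by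
  classical
  -- The greatest level $n\le k$ valid at $k$. The cap $k$ makes it exist and, since `ω` is free,
  -- does not keep it bounded; no monotonicity of `R` in $n$ is needed.
  refine ⟨fun k => Nat.findGreatest (fun n => R n k) k, ?_, ?_⟩
  · refine tendsto_atTop.2 fun N => ?_
    filter_upwards [hR N, eventually_ge_of_free hω N] with k h1 h2
    exact Nat.le_findGreatest h2 h1
  · filter_upwards [hR 0] with k h0
    exact Nat.findGreatest_spec (P := fun n => R n k) (Nat.zero_le k) h0

theorem permAct_mk (p : ∀ k, Equiv.Perm (Fin (d k))) (j : ∀ k, Fin (d k)) :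
    permAct ω p (LoebSpace.mk ω d j) = LoebSpace.mk ω d (fun k => p k (j k)) :=
  rfl

theorem permAct_preimage_internalSet (p : ∀ k, Equiv.Perm (Fin (d k)))
    (A : ∀ k, Set (Fin (d k))) :
    permAct ω p ⁻¹' internalSet ω A = internalSet ω (fun k => p k ⁻¹' A k) := by
  ext z
  obtain ⟨j, rfl⟩ := z.exists_rep
  rw [Set.mem_preimage, permAct_mk, mk_mem_internalSet, mk_mem_internalSet]
  rfl

theorem measurable_permAct (p : ∀ k, Equiv.Perm (Fin (d k))) :
    Measurable (permAct ω p) := by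
  refine measurable_generateFrom ?_
  rintro _ ⟨A, rfl⟩
  rw [permAct_preimage_internalSet]
  exact measurableSet_internalSet _

variable [∀ k, NeZero (d k)] (hω : ∀ s : Set ℕ, s.Finite → s ∉ ω)

include hω

theorem isProbabilityMeasure_loebMeasure : IsProbabilityMeasure (loebMeasure ω d) := by
  refine ⟨?_⟩
  rw [← internalSet_univ, loebMeasure_internalSet hω, limUnif_eq_one_iff]
  simp [unif_univ]

/-- The dictionary between almost sure statements on the Loeb space and asymptotic densities on the
finite sets. -/
theorem ae_mem_internalSet_iff (A : ∀ k, Set (Fin (d k))) :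
    (∀ᵐ z ∂loebMeasure ω d, z ∈ internalSet ω A) ↔
      Tendsto (fun k => unif (A k)) (ω : Filter ℕ) (𝓝 1) := by
  have := isProbabilityMeasure_loebMeasure (d := d) hω
  rw [← limUnif_eq_one_iff, ← loebMeasure_internalSet hω]
  exact mem_ae_iff_prob_eq_one (measurableSet_internalSet A)

theorem eventually_unif_lt_of_loebMeasure_lt {A : ∀ k, Set (Fin (d k))} {x : ℝ}
    (h : loebMeasure ω d (internalSet ω A) < ENNReal.ofReal x) :
    ∀ᶠ k in (ω : Filter ℕ), unif (A k) < x := by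
  rw [loebMeasure_internalSet hω] at h
  have hx : 0 < x := by
    by_contra hx
    simp [ENNReal.ofReal_of_nonpos (not_lt.1 hx)] at h
  filter_upwards [(tendsto_limUnif A).eventually_lt_const h] with k hk
  exact (ENNReal.ofReal_lt_ofReal_iff hx).1 hk

theorem loebMeasure_le_of_eventually_unif_le {A : ∀ k, Set (Fin (d k))} {x : ℝ}
    (h : ∀ᶠ k in (ω : Filter ℕ), unif (A k) ≤ x) :
    loebMeasure ω d (internalSet ω A) ≤ ENNReal.ofReal x := by
  rw [loebMeasure_internalSet hω]
  exact le_of_tendsto (tendsto_limUnif A) (h.mono fun k hk => ENNReal.ofReal_le_ofReal hk)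

theorem measurePreserving_permAct (p : ∀ k, Equiv.Perm (Fin (d k))) :
    MeasurePreserving (permAct ω p) (loebMeasure ω d) (loebMeasure ω d) := by
  have := isProbabilityMeasure_loebMeasure (d := d) hω
  have hm := measurable_permAct (ω := ω) p
  refine ⟨hm, ?_⟩
  have : IsProbabilityMeasure ((loebMeasure ω d).map (permAct ω p)) :=
    Measure.isProbabilityMeasure_map hm.aemeasurable
  refine ext_of_generate_finite (Set.range (internalSet ω)) rfl ?_ ?_ (by simp)
  · rintro _ ⟨A, rfl⟩ _ ⟨B, rfl⟩ -
    exact ⟨_, internalSet_inter A B⟩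
  · rintro _ ⟨A, rfl⟩
    rw [Measure.map_apply hm (measurableSet_internalSet A), permAct_preimage_internalSet,
      loebMeasure_internalSet hω, loebMeasure_internalSet hω]
    simp only [limUnif, unif_preimage_perm]

end LoebBasics

/-! ### Lifting measurable maps from the Loeb space to the finite sets -/

section Lifts

variable {ω : Ultrafilter ℕ} {d : ℕ → ℕ}

/-- `f` is a lift of `F`: almost surely `F [(j k)] = lim_{k → ω} f k (j k)`. -/
def IsLift {E : Type*} [TopologicalSpace E] (ω : Ultrafilter ℕ) {d : ℕ → ℕ}
    (f : ∀ k, Fin (d k) → E) (F : LoebSpace ω d → E) : Prop :=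
  ∀ᵐ z ∂loebMeasure ω d, ∀ j, LoebSpace.mk ω d j = z →
    Tendsto (fun k => f k (j k)) (ω : Filter ℕ) (𝓝 (F z))

theorem IsLift.congr {E : Type*} [TopologicalSpace E] {f : ∀ k, Fin (d k) → E}
    {F F' : LoebSpace ω d → E} (h : IsLift ω f F) (hF : F =ᵐ[loebMeasure ω d] F') :
    IsLift ω f F' := by
  filter_upwards [h, hF] with z h1 h2 j hj
  exact h2 ▸ h1 j hj

theorem IsLift.ae_eq {E : Type*} [TopologicalSpace E] [T2Space E] {f : ∀ k, Fin (d k) → E}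
    {F F' : LoebSpace ω d → E} (h : IsLift ω f F) (h' : IsLift ω f F') :
    F =ᵐ[loebMeasure ω d] F' := by
  filter_upwards [h, h'] with z h1 h2
  obtain ⟨j, hj⟩ := z.exists_rep
  exact tendsto_nhds_unique (h1 j hj) (h2 j hj)

theorem tendsto_ultralimit {E : Type*} [TopologicalSpace E] [CompactSpace E] [Nonempty E]
    (f : ∀ k, Fin (d k) → E) (j : ∀ k, Fin (d k)) :
    Tendsto (fun k => f k (j k)) (ω : Filter ℕ)
      (𝓝 (ultralimit ω f (LoebSpace.mk ω d j))) := by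
  obtain ⟨x, -, hx⟩ := isCompact_univ.ultrafilter_le_nhds
    (ω.map fun k => f k (j k)) (by simp)
  exact tendsto_nhds_limUnder ⟨x, hx⟩

theorem isLift_ultralimit {E : Type*} [TopologicalSpace E] [CompactSpace E] [Nonempty E]
    (f : ∀ k, Fin (d k) → E) : IsLift ω f (ultralimit ω f) := by
  refine Eventually.of_forall ?_
  rintro z j rfl
  exact tendsto_ultralimit f j

theorem isLift_iff_ae_eq_ultralimit {E : Type*} [TopologicalSpace E] [CompactSpace E] [T2Space E]
    [Nonempty E] {f : ∀ k, Fin (d k) → E} {F : LoebSpace ω d → E} :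
    IsLift ω f F ↔ F =ᵐ[loebMeasure ω d] ultralimit ω f :=
  ⟨fun h => h.ae_eq (isLift_ultralimit f), fun h => (isLift_ultralimit f).congr h.symm⟩

/-- The ultralimit lies in a closed set iff, for each $n$, the finite values eventually lie in its
closed $1/(n+1)$-thickening; so preimages of closed sets are countable intersections of internal
sets. -/
theorem aestronglyMeasurable_of_isLift {E : Type*} [TopologicalSpace E] [CompactSpace E]
    [TopologicalSpace.MetrizableSpace E] {f : ∀ k, Fin (d k) → E} {F : LoebSpace ω d → E}
    (h : IsLift ω f F) : AEStronglyMeasurable F (loebMeasure ω d) := by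
  let _ := TopologicalSpace.metrizableSpaceMetric E
  rcases isEmpty_or_nonempty E with hE | hE
  · have : IsEmpty (LoebSpace ω d) := ⟨fun z => hE.elim (F z)⟩
    exact (StronglyMeasurable.of_discrete (f := F)).aestronglyMeasurable
  borelize E
  suffices Measurable (ultralimit ω f) from
    (this.aemeasurable.congr (isLift_iff_ae_eq_ultralimit.1 h).symm).aestronglyMeasurable
  refine measurable_of_isClosed fun C hC => ?_
  have : ultralimit ω f ⁻¹' C =
      ⋂ n : ℕ, internalSet ω fun k => {j | f k j ∈ Metric.cthickening (1 / ((n : ℝ) + 1)) C} := by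
    ext z
    obtain ⟨j, rfl⟩ := z.exists_rep
    have ht := tendsto_ultralimit (ω := ω) f j
    simp only [Set.mem_preimage, Set.mem_iInter, mk_mem_internalSet, Set.mem_ofPred_eq]
    constructor
    · intro hz n
      have hn : (0 : ℝ) < 1 / ((n : ℝ) + 1) := by positivity
      have hnhds : Metric.thickening (1 / ((n : ℝ) + 1)) C ∈
          𝓝 (ultralimit ω f (LoebSpace.mk ω d j)) :=
        Metric.isOpen_thickening.mem_nhds (Metric.self_subset_thickening hn C hz)
      filter_upwards [ht hnhds] with k hk
      exact Metric.thickening_subset_cthickening _ _ hk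
    · intro hz
      rw [← hC.closure_eq, Metric.closure_eq_iInter_cthickening]
      refine Set.mem_iInter₂.2 fun ε hε => ?_
      obtain ⟨n, hn⟩ := exists_nat_one_div_lt hε
      exact Metric.cthickening_mono hn.le _
        (Metric.isClosed_cthickening.mem_of_tendsto ht (hz n))
  rw [this]
  exact MeasurableSet.iInter fun n => measurableSet_internalSet _

variable [∀ k, NeZero (d k)] (hω : ∀ s : Set ℕ, s.Finite → s ∉ ω)

include hω

/-- Lifts are closed under convergence in measure, along a slowly growing diagonal which may also
be required to have countably many properties that hold in the limit. -/
theorem IsLift.exists_diagonal {E : Type*} [PseudoMetricSpace E]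
    {f : ℕ → ∀ k, Fin (d k) → E} {F : ℕ → LoebSpace ω d → E} {F' : LoebSpace ω d → E}
    (hf : ∀ n, IsLift ω (f n) (F n)) (hF : TendstoInMeasure (loebMeasure ω d) F atTop F')
    {R : ℕ → ℕ → Prop} (hR : ∀ n, ∀ᶠ k in (ω : Filter ℕ), R n k) :
    ∃ n : ℕ → ℕ, Tendsto n (ω : Filter ℕ) atTop ∧ (∀ᶠ k in (ω : Filter ℕ), R (n k) k) ∧
      IsLift ω (fun k => f (n k) k) F' := by
  -- A subsequence along which the distance to `F'` is at least $2^{-n}$ only on a set of measure at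
  -- most $2^{-n}$.
  set s := ExistsSeqTendstoAe.seqTendstoAeSeq hF with hs
  have hsm : StrictMono s := ExistsSeqTendstoAe.seqTendstoAeSeq_strictMono hF
  set c : ℕ → ℝ := fun n => 2⁻¹ ^ n with hc
  have hc0 : ∀ n, 0 < c n := fun n => by positivity
  have hcE : ∀ n, ENNReal.ofReal (c n) = (2 : ℝ≥0∞)⁻¹ ^ n := fun n => by
    rw [hc, ENNReal.ofReal_pow (by positivity), ENNReal.ofReal_inv_of_pos (by positivity)]
    simp
  let D : ℕ → Set (LoebSpace ω d) := fun n => {z | c n ≤ dist (F (s n) z) (F' z)}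
  have hD : ∀ n, loebMeasure ω d (D n) ≤ ENNReal.ofReal (c n) := fun n => by
    rw [hcE]
    refine le_trans (measure_mono fun z hz => ?_)
      (ExistsSeqTendstoAe.seqTendstoAeSeq_spec hF n _ le_rfl)
    show (2 : ℝ≥0∞)⁻¹ ^ n ≤ edist _ _
    rw [← hcE, edist_dist]
    exact ENNReal.ofReal_le_ofReal hz
  -- Off `D m ∪ D n` the two limits differ by less than $c_m+c_n\le 2c_m$, and this union has
  -- measure at most $2c_m$; the constant 3 leaves room for strict inequalities.
  have hpair : ∀ m n, m ≤ n → ∀ᶠ k in (ω : Filter ℕ),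
      unif {j | 3 * c m ≤ dist (f (s m) k j) (f (s n) k j)} < 3 * c m := by
    intro m n hmn
    refine eventually_unif_lt_of_loebMeasure_lt hω (lt_of_le_of_lt
      (measure_mono_ae (t := D m ∪ D n) ?_) (((measure_union_le _ _).trans
      (add_le_add (hD m) (hD n))).trans_lt ?_))
    · filter_upwards [hf (s m), hf (s n)] with z h1 h2
      intro hz
      obtain ⟨j, rfl⟩ := z.exists_rep
      have hle : 3 * c m ≤ dist (F (s m) (LoebSpace.mk ω d j)) (F (s n) (LoebSpace.mk ω d j)) :=
        ge_of_tendsto ((h1 j rfl).dist (h2 j rfl)) (mk_mem_internalSet.1 hz)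
      by_contra hcon
      have h3 : ¬ (c m ≤ _) ∧ ¬ (c n ≤ _) := not_or.1 hcon
      have hcn : c n ≤ c m := pow_le_pow_of_le_one (by norm_num) (by norm_num) hmn
      have := dist_triangle_right (F (s m) (LoebSpace.mk ω d j)) (F (s n) (LoebSpace.mk ω d j))
        (F' (LoebSpace.mk ω d j))
      linarith [not_le.1 h3.1, not_le.1 h3.2, hc0 m]
    · rw [← ENNReal.ofReal_add (hc0 m).le (hc0 n).le]
      refine (ENNReal.ofReal_lt_ofReal_iff (by linarith [hc0 m])).2 ?_
      have hcn : c n ≤ c m := pow_le_pow_of_le_one (by norm_num) (by norm_num) hmn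
      linarith [hc0 m]
  obtain ⟨n, hn, hRn⟩ := exists_tendsto_level hω
    (R := fun n k => R (s n) k ∧ ∀ m ∈ Finset.range (n + 1),
      unif {j | 3 * c m ≤ dist (f (s m) k j) (f (s n) k j)} < 3 * c m)
    (fun n => (hR (s n)).and ((Filter.eventually_all_finset _).2 fun m hm =>
      hpair m n (Nat.lt_succ_iff.1 (Finset.mem_range.1 hm))))
  refine ⟨fun k => s (n k), hsm.tendsto_atTop.comp hn, hRn.mono fun k hk => hk.1, ?_⟩
  let B : ℕ → Set (LoebSpace ω d) := fun m =>
    internalSet ω fun k => {j | 3 * c m ≤ dist (f (s m) k j) (f (s (n k)) k j)}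
  have hB : ∀ m, loebMeasure ω d (B m) ≤ ENNReal.ofReal (3 * c m) := fun m => by
    refine loebMeasure_le_of_eventually_unif_le hω ?_
    filter_upwards [hRn, hn.eventually_ge_atTop m] with k h1 h2
    exact (h1.2 m (Finset.mem_range.2 (Nat.lt_succ_iff.2 h2))).le
  have hsum : Summable c := summable_geometric_of_lt_one (by norm_num) (by norm_num)
  -- Borel–Cantelli, for the errors of `F (s m)` and for the finite discrepancies between `f (s m)`
  -- and the diagonal. At a good $m$ the total error is at most $3c_m+c_m+c_m$, whence the factor 5
  -- below.
  have hDae := ae_eventually_notMem (ne_top_of_le_ne_top hsum.tsum_ofReal_ne_top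
    (ENNReal.tsum_le_tsum hD))
  have hBae := ae_eventually_notMem (ne_top_of_le_ne_top (hsum.mul_left 3).tsum_ofReal_ne_top
    (ENNReal.tsum_le_tsum hB))
  filter_upwards [hDae, hBae, ae_all_iff.2 fun m => hf (s m)] with z h1 h2 h3
  rintro j rfl
  refine Metric.tendsto_nhds.2 fun ε hε => ?_
  have hc5 : Tendsto (fun m => 5 * c m) atTop (𝓝 0) := by
    simpa using hsum.tendsto_atTop_zero.const_mul 5
  obtain ⟨m, hmD, hmB, hm⟩ := (h1.and (h2.and (hc5.eventually_lt_const hε))).exists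
  have hmB' := Ultrafilter.eventually_not.2 fun h => hmB (mk_mem_internalSet.2 h)
  filter_upwards [hmB', Metric.tendsto_nhds.1 (h3 m j rfl) (c m) (hc0 m)] with k hk1 hk2
  have hk1' : dist (f (s m) k (j k)) (f (s (n k)) k (j k)) < 3 * c m := not_le.1 hk1
  have hmD' : dist (F (s m) (LoebSpace.mk ω d j)) (F' (LoebSpace.mk ω d j)) < c m :=
    not_le.1 hmD
  have t1 := dist_triangle_left (f (s (n k)) k (j k)) (F' (LoebSpace.mk ω d j))
    (f (s m) k (j k))
  have t2 := dist_triangle (f (s m) k (j k)) (F (s m) (LoebSpace.mk ω d j))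
    (F' (LoebSpace.mk ω d j))
  linarith

/-- Induction on the generated σ-algebra. Only countable unions need an argument: their indicators
are limits of indicators of finite unions, hence have a lift, and cutting that lift at $1/2$ gives
an internal set. -/
theorem exists_internalSet_ae_eq {S : Set (LoebSpace ω d)} (hS : MeasurableSet S) :
    ∃ A : ∀ k, Set (Fin (d k)), ∀ᵐ z ∂loebMeasure ω d, z ∈ S ↔ z ∈ internalSet ω A := by
  classical
  have := isProbabilityMeasure_loebMeasure (d := d) hω
  have key : ∀ S : Set (LoebSpace ω d),
      (∃ f : ∀ k, Fin (d k) → ℝ, IsLift ω f (S.indicator 1)) →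
      ∃ A : ∀ k, Set (Fin (d k)), ∀ᵐ z ∂loebMeasure ω d, z ∈ S ↔ z ∈ internalSet ω A := by
    rintro S ⟨f, hf⟩
    refine ⟨fun k => {j | 1 / 2 < f k j}, ?_⟩
    filter_upwards [hf] with z hz
    obtain ⟨j, rfl⟩ := z.exists_rep
    have h1 := hz j rfl
    rw [mk_mem_internalSet]
    by_cases hj : LoebSpace.mk ω d j ∈ S
    · simp only [hj, Set.indicator_of_mem, Pi.one_apply, true_iff] at h1 ⊢
      exact h1.eventually_const_lt (by norm_num)
    · simp only [hj, Set.indicator_of_notMem, not_false_eq_true, false_iff] at h1 ⊢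
      refine Ultrafilter.eventually_not.1 ?_
      filter_upwards [h1.eventually_lt_const (u := 1 / 2) (by norm_num)] with k hk
      exact not_lt.2 hk.le
  have key' : ∀ (S : Set (LoebSpace ω d)) (A : ∀ k, Set (Fin (d k))),
      (∀ᵐ z ∂loebMeasure ω d, z ∈ S ↔ z ∈ internalSet ω A) →
      IsLift ω (fun k => (A k).indicator (1 : Fin (d k) → ℝ)) (S.indicator 1) := by
    intro S A hA
    filter_upwards [hA] with z hz
    rintro j rfl
    rw [mk_mem_internalSet] at hz
    refine tendsto_const_nhds.congr' ?_
    by_cases hj : LoebSpace.mk ω d j ∈ S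
    · filter_upwards [hz.1 hj] with k hk
      simp [hj, hk]
    · filter_upwards [Ultrafilter.eventually_not.2 (mt hz.2 hj)] with k hk
      simp [hj, hk]
  have hunion : ∀ S T : Set (LoebSpace ω d),
      (∃ A : ∀ k, Set (Fin (d k)), ∀ᵐ z ∂loebMeasure ω d, z ∈ S ↔ z ∈ internalSet ω A) →
      (∃ A : ∀ k, Set (Fin (d k)), ∀ᵐ z ∂loebMeasure ω d, z ∈ T ↔ z ∈ internalSet ω A) →
      ∃ A : ∀ k, Set (Fin (d k)), ∀ᵐ z ∂loebMeasure ω d, z ∈ S ∪ T ↔ z ∈ internalSet ω A := by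
    rintro S T ⟨A, hA⟩ ⟨B, hB⟩
    refine ⟨fun k => A k ∪ B k, ?_⟩
    filter_upwards [hA, hB] with z h1 h2
    obtain ⟨j, rfl⟩ := z.exists_rep
    rw [Set.mem_union, h1, h2]
    simp only [mk_mem_internalSet, Set.mem_union, Ultrafilter.eventually_or]
  refine MeasurableSpace.generateFrom_induction _ (fun S _ => ∃ A : ∀ k, Set (Fin (d k)),
    ∀ᵐ z ∂loebMeasure ω d, z ∈ S ↔ z ∈ internalSet ω A) ?_ ?_ ?_ ?_ S hS
  · rintro _ ⟨A, rfl⟩ -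
    exact ⟨A, by simp⟩
  · exact ⟨fun _ => ∅, by simp [internalSet_empty]⟩
  · rintro T - ⟨A, hA⟩
    refine ⟨fun k => (A k)ᶜ, ?_⟩
    filter_upwards [hA] with z hz
    rw [internalSet_compl, Set.mem_compl_iff, Set.mem_compl_iff, hz]
  · intro T hT hTA
    apply key
    have hacc : ∀ n, ∃ A : ∀ k, Set (Fin (d k)), ∀ᵐ z ∂loebMeasure ω d,
        z ∈ ⋃ i ∈ Finset.range n, T i ↔ z ∈ internalSet ω A := by
      intro n
      induction n with
      | zero => exact ⟨fun _ => ∅, by simp [internalSet_empty]⟩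
      | succ n ih =>
        rw [Finset.range_add_one, Finset.set_biUnion_insert]
        exact hunion _ _ (hTA n) ih
    choose A hA using hacc
    have hmeas : ∀ n, AEStronglyMeasurable
        ((⋃ i ∈ Finset.range n, T i).indicator (1 : LoebSpace ω d → ℝ)) (loebMeasure ω d) :=
      fun n => (measurable_one.indicator
        (Finset.measurableSet_biUnion _ fun i _ => hT i)).aestronglyMeasurable
    have hlim : ∀ z, Tendsto
        (fun n => (⋃ i ∈ Finset.range n, T i).indicator (1 : LoebSpace ω d → ℝ) z) atTop
        (𝓝 ((⋃ i, T i).indicator 1 z)) := by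
      intro z
      refine tendsto_const_nhds.congr' ?_
      by_cases hz : z ∈ ⋃ i, T i
      · obtain ⟨i, hi⟩ := Set.mem_iUnion.1 hz
        filter_upwards [eventually_gt_atTop i] with n hn
        have : z ∈ ⋃ i ∈ Finset.range n, T i := Set.mem_biUnion (by simpa using hn) hi
        exact (Set.indicator_of_mem hz _).trans (Set.indicator_of_mem this _).symm
      · refine Eventually.of_forall fun n => ?_
        have : z ∉ ⋃ i ∈ Finset.range n, T i := fun h => hz
          (Set.iUnion₂_subset (fun i _ => Set.subset_iUnion T i) h)
        exact (Set.indicator_of_notMem hz _).trans (Set.indicator_of_notMem this _).symm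
    obtain ⟨n, -, -, hn⟩ := IsLift.exists_diagonal hω (R := fun _ _ => True)
      (fun n => key' _ (A n) (hA n))
      (tendstoInMeasure_of_tendsto_ae hmeas (Eventually.of_forall hlim))
      (fun _ => Eventually.of_forall fun _ => trivial)
    exact ⟨_, hn⟩

theorem exists_isLift_simpleFunc {E : Type*} [TopologicalSpace E]
    (F : SimpleFunc (LoebSpace ω d) E) :
    ∃ f : ∀ k, Fin (d k) → E, IsLift ω f F := by
  classical
  rcases isEmpty_or_nonempty (LoebSpace ω d) with hZ | ⟨⟨z₀⟩⟩
  · have := isProbabilityMeasure_loebMeasure (d := d) hω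
    exact absurd (measure_univ (μ := loebMeasure ω d)) (by simp [Set.univ_eq_empty_iff.2 hZ])
  choose A hA using fun e : E => exists_internalSet_ae_eq hω (F.measurableSet_fiber e)
  -- The sets `A e k` need not partition the finite set. Along almost every point, eventually
  -- exactly one contains `j k`, so neither the choice nor the default value matters.
  refine ⟨fun k j => if h : ∃ e ∈ F.range, j ∈ A e k then h.choose else F z₀, ?_⟩
  filter_upwards [(Filter.eventually_all_finset F.range).2 fun e _ => hA e] with z hz
  rintro j rfl
  set z := LoebSpace.mk ω d j with hzdef
  have h1 : ∀ᶠ k in (ω : Filter ℕ), ∀ e ∈ F.range, j k ∈ A e k ↔ F z = e := by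
    refine (Filter.eventually_all_finset F.range).2 fun e he => ?_
    have h2 := hz e he
    rw [mk_mem_internalSet] at h2
    by_cases hze : F z = e
    · filter_upwards [h2.1 hze] with k hk
      simp [hk, hze]
    · filter_upwards [Ultrafilter.eventually_not.2 (mt h2.2 hze)] with k hk
      simp [hk, hze]
  refine tendsto_const_nhds.congr' ?_
  filter_upwards [h1] with k hk
  have hex : ∃ e ∈ F.range, j k ∈ A e k :=
    ⟨F z, F.mem_range_self z, (hk _ (F.mem_range_self z)).2 rfl⟩
  rw [dif_pos hex]
  exact (hk _ hex.choose_spec.1).1 hex.choose_spec.2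

/-- Every measurable map on the Loeb space lifts to the finite sets. -/
theorem exists_isLift {E : Type*} [TopologicalSpace E] [TopologicalSpace.PseudoMetrizableSpace E]
    {F : LoebSpace ω d → E} (hF : AEStronglyMeasurable F (loebMeasure ω d)) :
    ∃ f : ∀ k, Fin (d k) → E, IsLift ω f F := by
  let _ := TopologicalSpace.pseudoMetrizableSpacePseudoMetric E
  have := isProbabilityMeasure_loebMeasure (d := d) hω
  obtain ⟨F', hF', hFF'⟩ := hF
  choose f hf using fun n => exists_isLift_simpleFunc hω (hF'.approx n)
  obtain ⟨n, -, -, hn⟩ := IsLift.exists_diagonal hω (F' := F') (R := fun _ _ => True) hf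
    (tendstoInMeasure_of_tendsto_ae
      (fun n => (hF'.approx n).stronglyMeasurable.aestronglyMeasurable)
      (Eventually.of_forall hF'.tendsto_approx))
    (fun _ => Eventually.of_forall fun _ => trivial)
  exact ⟨_, hn.congr hFF'.symm⟩

/-- For uniformly bounded nonnegative functions, averages tend to zero if and only if the
ultralimit vanishes almost everywhere. -/
theorem isLift_zero_iff {r : ∀ k, Fin (d k) → ℝ} {C : ℝ} (h0 : ∀ k j, 0 ≤ r k j)
    (hC : ∀ k j, r k j ≤ C) :
    IsLift ω r (fun _ => 0) ↔
      Tendsto (fun k => (∑ j, r k j) / d k) (ω : Filter ℕ) (𝓝 0) := by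
  have hd : ∀ k, (0 : ℝ) < d k := fun k => by exact_mod_cast Nat.pos_of_ne_zero (NeZero.ne (d k))
  have hlift : IsLift ω r (fun _ => 0) ↔
      ∀ n : ℕ, ∀ᵐ z ∂loebMeasure ω d,
        z ∈ internalSet ω fun k => {j | r k j < 1 / ((n : ℝ) + 1)} := by
    rw [← ae_all_iff]
    refine eventually_congr (Eventually.of_forall fun z => ?_)
    obtain ⟨j, rfl⟩ := z.exists_rep
    simp only [mk_mem_internalSet, Set.mem_ofPred_eq]
    constructor
    · intro h n
      exact (h j rfl).eventually_lt_const (by positivity)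
    · intro h j' hj'
      refine Metric.tendsto_nhds.2 fun ε hε => ?_
      obtain ⟨n, hn⟩ := exists_nat_one_div_lt hε
      filter_upwards [h n, LoebSpace.mk_eq_mk.1 hj'] with k h1 h2
      rw [Real.dist_eq, sub_zero, h2, abs_of_nonneg (h0 _ _)]
      exact h1.trans hn
  have hcompl : ∀ k (a : ℝ), unif {j | r k j < a} = 1 - unif {j | a ≤ r k j} := fun k a => by
    rw [← unif_compl]
    congr 1
    ext j
    simp
  have hunif : ∀ k (A : Set (Fin (d k))) [DecidablePred (· ∈ A)],
      unif A * d k = ∑ j, if j ∈ A then (1 : ℝ) else 0 := by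
    intro k A _
    rw [unif, div_mul_cancel₀ _ (hd k).ne', Finset.sum_boole, Set.ncard_eq_toFinset_card']
    congr 2
    ext j
    simp
  rw [hlift]
  simp only [ae_mem_internalSet_iff hω, hcompl]
  classical
  constructor
  · intro h
    have hC0 : 0 ≤ C := (h0 0 0).trans (hC 0 0)
    refine Metric.tendsto_nhds.2 fun ε hε => ?_
    obtain ⟨n, hn⟩ := exists_nat_one_div_lt (half_pos hε)
    have h1 : Tendsto (fun k => C * unif {j | 1 / ((n : ℝ) + 1) ≤ r k j}) (ω : Filter ℕ) (𝓝 0) := by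
      simpa using ((h n).const_sub 1).const_mul C
    filter_upwards [h1.eventually_lt_const (half_pos hε)] with k hk
    rw [Real.dist_eq, sub_zero, abs_of_nonneg
      (div_nonneg (Finset.sum_nonneg fun j _ => h0 k j) (hd k).le), div_lt_iff₀ (hd k)]
    -- Below the threshold bound by $1/(n+1)$, above it by $C$. The converse is Markov's inequality.
    calc ∑ j, r k j ≤ ∑ j, (1 / ((n : ℝ) + 1) +
          C * if j ∈ {j | 1 / ((n : ℝ) + 1) ≤ r k j} then 1 else 0) := by
          refine Finset.sum_le_sum fun j _ => ?_
          split_ifs with hj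
          · have := hC k j
            have : (0 : ℝ) ≤ 1 / ((n : ℝ) + 1) := by positivity
            linarith
          · have : r k j < 1 / ((n : ℝ) + 1) := not_le.1 hj
            linarith
      _ = 1 / ((n : ℝ) + 1) * d k + C * unif {j | 1 / ((n : ℝ) + 1) ≤ r k j} * d k := by
          rw [Finset.sum_add_distrib, ← Finset.mul_sum, ← hunif]
          simp
          ring
      _ < ε * d k := by
          rw [← add_mul]
          exact mul_lt_mul_of_pos_right (by linarith) (hd k)
  · intro h n
    have hn : (0 : ℝ) < 1 / ((n : ℝ) + 1) := by positivity
    suffices Tendsto (fun k => unif {j | 1 / ((n : ℝ) + 1) ≤ r k j}) (ω : Filter ℕ) (𝓝 0) by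
      simpa using this.const_sub 1
    refine tendsto_of_tendsto_of_tendsto_of_le_of_le tendsto_const_nhds
      (by simpa using h.const_mul ((n : ℝ) + 1)) (fun k => unif_nonneg _) fun k => ?_
    show unif _ ≤ ((n : ℝ) + 1) * ((∑ j, r k j) / d k)
    rw [← mul_div_assoc, le_div_iff₀ (hd k), hunif, Finset.mul_sum]
    refine Finset.sum_le_sum fun j _ => ?_
    split_ifs with hj
    · have : 1 / ((n : ℝ) + 1) ≤ r k j := hj
      rwa [div_le_iff₀ (by positivity), mul_comm] at this
    · exact mul_nonneg (by positivity) (h0 k j)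

end Lifts

/-! ### Random walks on countable groups -/

section AlmostInvariant

open scoped MeasureTheory.Measure

/-- The convolution powers of a measure. -/
noncomputable def convPow {Γ : Type*} [Monoid Γ] [MeasurableSpace Γ] (p : Measure Γ) :
    ℕ → Measure Γ
  | 0 => Measure.dirac 1
  | n + 1 => Measure.mconv (convPow p n) p

variable {Γ : Type*} [Group Γ] [Countable Γ] [MeasurableSpace Γ] [DiscreteMeasurableSpace Γ]

theorem isProbabilityMeasure_convPow (p : Measure Γ) [IsProbabilityMeasure p] (n : ℕ) :
    IsProbabilityMeasure (convPow p n) := by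
  induction n with
  | zero => exact Measure.dirac.isProbabilityMeasure
  | succ n ih => exact Measure.probabilitymeasure_of_probabilitymeasures_mconv _ _

/-- The Cesàro averages of the convolution powers of a measure. -/
noncomputable def convAverage (p : Measure Γ) (n : ℕ) : Measure Γ :=
  ((n : ℝ≥0∞) + 1)⁻¹ • ∑ a ∈ Finset.range (n + 1), convPow p a

theorem isProbabilityMeasure_convAverage (p : Measure Γ) [IsProbabilityMeasure p] (n : ℕ) :
    IsProbabilityMeasure (convAverage p n) := by
  refine ⟨?_⟩
  have := isProbabilityMeasure_convPow p
  rw [convAverage, Measure.smul_apply, Measure.finsetSum_apply]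
  simp only [measure_univ, Finset.sum_const, Finset.card_range, nsmul_eq_mul, mul_one, smul_eq_mul,
    Nat.cast_add, Nat.cast_one]
  exact ENNReal.inv_mul_cancel (by simp) (by simp)

/-- The Cesàro averages of the convolution powers, as probability measures. -/
noncomputable def convAverageProb (p : Measure Γ) [IsProbabilityMeasure p] (n : ℕ) :
    ProbabilityMeasure Γ :=
  ⟨convAverage p n, isProbabilityMeasure_convAverage p n⟩

omit [Group Γ] in
theorem integrable_of_forall_norm_le {μ : Measure Γ} [IsFiniteMeasure μ] {g : Γ → ℝ} {C : ℝ}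
    (hg : ∀ x, ‖g x‖ ≤ C) : Integrable g μ :=
  Integrable.of_bound AEStronglyMeasurable.of_discrete C (Eventually.of_forall hg)

theorem norm_integral_le_of_forall_norm_le {α : Type*} [MeasurableSpace α] {μ : Measure α}
    [IsProbabilityMeasure μ] {g : α → ℝ} {C : ℝ} (hg : ∀ x, ‖g x‖ ≤ C) : ‖∫ x, g x ∂μ‖ ≤ C := by
  simpa using norm_integral_le_of_norm_le_const (μ := μ) (Eventually.of_forall hg)

/-- One further step of the walk shifts the convolution powers by one, so the difference telescopes
to two boundary terms divided by $n+1$. -/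
theorem tendsto_integral_convAverage_sub (p : Measure Γ) [IsProbabilityMeasure p] {g : Γ → ℝ}
    {C : ℝ} (hg : ∀ x, ‖g x‖ ≤ C) :
    Tendsto (fun n => (∫ x, ∫ y, g (x * y) ∂p ∂convAverage p n) - ∫ x, g x ∂convAverage p n)
      atTop (𝓝 0) := by
  have := isProbabilityMeasure_convPow p
  have hsum : ∀ n (h : Γ → ℝ), (∀ x, ‖h x‖ ≤ C) → ∫ x, h x ∂convAverage p n =
      ((n : ℝ) + 1)⁻¹ * ∑ a ∈ Finset.range (n + 1), ∫ x, h x ∂convPow p a := by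
    intro n h hh
    rw [convAverage, integral_smul_measure, integral_finsetSum_measure
      (fun a _ => integrable_of_forall_norm_le hh), smul_eq_mul]
    congr 1
    rw [ENNReal.toReal_inv, ENNReal.toReal_add (by simp) (by simp)]
    simp
  have hstep : ∀ a, ∫ x, ∫ y, g (x * y) ∂p ∂convPow p a = ∫ x, g x ∂convPow p (a + 1) := by
    intro a
    rw [convPow, integral_mconv (integrable_of_forall_norm_le hg)]
  have heq : ∀ n : ℕ, (∫ x, ∫ y, g (x * y) ∂p ∂convAverage p n) - ∫ x, g x ∂convAverage p n =
      ((n : ℝ) + 1)⁻¹ * ((∫ x, g x ∂convPow p (n + 1)) - ∫ x, g x ∂convPow p 0) := by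
    intro n
    rw [hsum n _ (fun x => norm_integral_le_of_forall_norm_le fun y => hg _), hsum n _ hg,
      ← mul_sub, ← Finset.sum_sub_distrib]
    simp only [hstep]
    rw [Finset.sum_range_sub (fun a => ∫ x, g x ∂convPow p a)]
  have hC : Tendsto (fun n : ℕ => (1 / ((n : ℝ) + 1)) * (C + C)) atTop (𝓝 0) := by
    simpa using tendsto_one_div_add_atTop_nhds_zero_nat.mul_const (C + C)
  refine squeeze_zero_norm (fun n => ?_) hC
  rw [heq, norm_mul, one_div]
  refine mul_le_mul (le_of_eq ?_) ((norm_sub_le _ _).trans (add_le_add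
    (norm_integral_le_of_forall_norm_le hg) (norm_integral_le_of_forall_norm_le hg)))
    (norm_nonneg _) (by positivity)
  exact Real.norm_of_nonneg (by positivity)

omit [Group Γ] in
theorem exists_isProbabilityMeasure_forall_singleton_ne_zero [Nonempty Γ] :
    ∃ p : Measure Γ, IsProbabilityMeasure p ∧ ∀ x, p {x} ≠ 0 := by
  obtain ⟨f, hf⟩ := exists_surjective_nat Γ
  refine ⟨Measure.sum fun n : ℕ => (2⁻¹ : ℝ≥0∞) ^ (n + 1) • Measure.dirac (f n), ⟨?_⟩, ?_⟩
  · rw [Measure.sum_apply _ MeasurableSet.univ]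
    simp [ENNReal.tsum_geometric_add_one, ENNReal.inv_mul_cancel]
  · intro x
    obtain ⟨n, rfl⟩ := hf x
    rw [Measure.sum_apply _ (measurableSet_singleton _)]
    refine (ENNReal.tsum_eq_zero.not.2 ?_)
    push Not
    exact ⟨n, by simp⟩

-- Dominated convergence for integrals can fail along a free ultrafilter. Over a countable space the
-- integral is a sum, and dominated convergence of sums holds along every filter.
omit [Group Γ] in
theorem tendsto_integral_of_forall_tendsto {ι : Type*} {l : Filter ι} {κ : Measure Γ}
    [IsProbabilityMeasure κ] {h : ι → Γ → ℝ} {g : Γ → ℝ} {C : ℝ} (hC : ∀ i x, ‖h i x‖ ≤ C)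
    (hgC : ∀ x, ‖g x‖ ≤ C)
    (hlim : ∀ x, Tendsto (fun i => h i x) l (𝓝 (g x))) :
    Tendsto (fun i => ∫ x, h i x ∂κ) l (𝓝 (∫ x, g x ∂κ)) := by
  rw [integral_countable (integrable_of_forall_norm_le hgC)]
  simp only [fun i => integral_countable (μ := κ) (integrable_of_forall_norm_le (hC i))]
  have hκ : ∑' x, κ {x} ≠ ∞ := by
    have := lintegral_countable' (μ := κ) (1 : Γ → ℝ≥0∞)
    simp only [Pi.one_apply, one_mul] at this
    simp [← this]
  have hs : Summable fun x => κ.real {x} * C := (ENNReal.summable_toReal hκ).mul_right C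
  refine tendsto_tsum_of_dominated_convergence hs (fun x => (hlim x).const_smul _)
    (Eventually.of_forall fun i x => ?_)
  rw [norm_smul, Real.norm_of_nonneg measureReal_nonneg]
  exact mul_le_mul_of_nonneg_left (hC i x) measureReal_nonneg

end AlmostInvariant

/-! ### Weak* limits and Haar measures of closed subgroups -/

theorem exists_forall_norm_le_of_compactSpace {X : Type*} [TopologicalSpace X] [CompactSpace X]
    (f : C(X, ℝ)) : ∃ C, ∀ x, ‖f x‖ ≤ C :=
  ⟨‖f‖, f.norm_coe_le_norm⟩

theorem tendsto_integral_of_tendsto {X ι : Type*} [TopologicalSpace X] [CompactSpace X]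
    [MeasurableSpace X] [OpensMeasurableSpace X] {l : Filter ι} {μ : ι → ProbabilityMeasure X}
    {ν : ProbabilityMeasure X} (h : Tendsto μ l (𝓝 ν)) (f : C(X, ℝ)) :
    Tendsto (fun i => ∫ x, f x ∂(μ i : Measure X)) l (𝓝 (∫ x, f x ∂(ν : Measure X))) :=
  ProbabilityMeasure.tendsto_iff_forall_integral_tendsto.1 h
    (BoundedContinuousFunction.mkOfCompact f)

theorem integrable_of_continuous {X : Type*} [TopologicalSpace X] [CompactSpace X]
    [MeasurableSpace X] [OpensMeasurableSpace X] (μ : Measure X) [IsFiniteMeasure μ] {f : X → ℝ}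
    (hf : Continuous f) : Integrable f μ :=
  (BoundedContinuousFunction.mkOfCompact ⟨f, hf⟩).integrable μ

theorem measure_eq_one_of_integral_infDist_eq_zero {X : Type*} [MetricSpace X] [CompactSpace X]
    [MeasurableSpace X] [BorelSpace X] {μ : Measure X} [IsProbabilityMeasure μ] {K : Set X}
    (hK : IsClosed K) (hne : K.Nonempty) (h : ∫ x, Metric.infDist x K ∂μ = 0) : μ K = 1 := by
  have h0 := (integral_eq_zero_iff_of_nonneg (fun x => Metric.infDist_nonneg)
    (integrable_of_continuous μ (Metric.continuous_infDist_pt K))).1 h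
  refine (mem_ae_iff_prob_eq_one hK.measurableSet).1 ?_
  filter_upwards [h0] with x hx
  exact (hK.mem_iff_infDist_zero hne).2 hx

section Haar

variable {X : Type*} [Group X] [TopologicalSpace X] [IsTopologicalGroup X] [CompactSpace X]
  [MeasurableSpace X] [BorelSpace X]

theorem integral_subgroupHaar (H : ClosedSubgroup X) (f : X → ℝ) (hf : Continuous f) :
    haveI : CompactSpace H.toSubgroup := isCompact_iff_compactSpace.mp H.isClosed'.isCompact
    ∫ x, f x ∂(subgroupHaar H : Measure X) =
      ∫ h, f h ∂(haarProb H.toSubgroup : Measure H.toSubgroup) := by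
  rw [subgroupHaar, ProbabilityMeasure.toMeasure_map]
  exact integral_map measurable_subtype_coe.aemeasurable
    hf.measurable.stronglyMeasurable.aestronglyMeasurable

/-- Haar measure charges every nonempty open subset of $H$, so the relatively open null set
$H\setminus K$ is empty. -/
theorem subset_of_subgroupHaar_eq_one {H : ClosedSubgroup X} {K : Set X} (hK : IsClosed K)
    (h : (subgroupHaar H : Measure X) K = 1) : (H : Set X) ⊆ K := by
  have : CompactSpace H.toSubgroup := isCompact_iff_compactSpace.mp H.isClosed'.isCompact
  rw [subgroupHaar, ProbabilityMeasure.toMeasure_map,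
    Measure.map_apply measurable_subtype_coe hK.measurableSet] at h
  have hc : IsClosed (((↑) : H.toSubgroup → X) ⁻¹' K) := hK.preimage continuous_subtype_val
  have h0 : Measure.haarMeasure ⊤ (((↑) : H.toSubgroup → X) ⁻¹' K)ᶜ = 0 :=
    (prob_compl_eq_zero_iff (μ := (haarProb H.toSubgroup : Measure H.toSubgroup))
      hc.measurableSet).2 h
  have hpos : (Measure.haarMeasure (⊤ : TopologicalSpace.PositiveCompacts
      H.toSubgroup)).IsOpenPosMeasure := inferInstance
  rw [hc.isOpen_compl.measure_eq_zero_iff (Measure.haarMeasure ⊤)] at h0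
  intro x hx
  have : (⟨x, hx⟩ : H.toSubgroup) ∈ ((↑) : H.toSubgroup → X) ⁻¹' K := by
    rw [Set.compl_empty_iff.1 h0]
    trivial
  exact this

/-- Integrate $f(xh)$ over $q\times m_H$ in both orders: right invariance of $q$ yields $\int
f\,dq$, and left invariance of $m_H$, applied for $x\in H$, yields $\int f\,dm_H$. -/
theorem eq_subgroupHaar [TopologicalSpace.MetrizableSpace X] {H : ClosedSubgroup X}
    {q : ProbabilityMeasure X}
    (hH : (q : Measure X) H = 1)
    (hinv : ∀ f : C(X, ℝ), ∀ h ∈ H, ∫ x, f (x * h) ∂(q : Measure X) = ∫ x, f x ∂(q : Measure X)) :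
    q = subgroupHaar H := by
  have hcpt : CompactSpace H.toSubgroup := isCompact_iff_compactSpace.mp H.isClosed'.isCompact
  let _ := TopologicalSpace.metrizableSpaceMetric X
  refine Subtype.ext (ext_of_forall_integral_eq_of_IsFiniteMeasure (μ := (q : Measure X))
    (ν := (subgroupHaar H : Measure X)) fun f => ?_)
  show ∫ x, f x ∂(q : Measure X) = ∫ x, f x ∂(subgroupHaar H : Measure X)
  rw [integral_subgroupHaar H f f.continuous]
  set m := (haarProb H.toSubgroup : Measure H.toSubgroup) with hm
  have hml : m.IsMulLeftInvariant := by
    rw [show m = Measure.haarMeasure ⊤ from rfl]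
    infer_instance
  calc ∫ x, f x ∂(q : Measure X) = ∫ h : H.toSubgroup, ∫ x, f (x * h) ∂(q : Measure X) ∂m := by
        have h1 : ∀ h : H.toSubgroup, ∫ x, f (x * h) ∂(q : Measure X) = ∫ x, f x ∂(q : Measure X) :=
          fun h => hinv f.toContinuousMap h h.2
        simp [h1]
    _ = ∫ x, ∫ h : H.toSubgroup, f (x * h) ∂m ∂(q : Measure X) := by
        refine integral_integral_swap ?_
        exact integrable_of_continuous _ (by fun_prop)
    _ = ∫ x, ∫ h : H.toSubgroup, f h ∂m ∂(q : Measure X) := by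
        refine integral_congr_ae ?_
        filter_upwards [(mem_ae_iff_prob_eq_one H.isClosed'.measurableSet).2 hH] with x hx
        exact integral_mul_left_eq_self (μ := m) (fun h : H.toSubgroup => f h) ⟨x, hx⟩
    _ = ∫ h : H.toSubgroup, f h ∂m := by simp

theorem subgroupHaar_wholeGroup [TopologicalSpace.MetrizableSpace X] :
    subgroupHaar (wholeGroup X) = haarProb X := by
  have : CompactSpace (wholeGroup X).toSubgroup :=
    isCompact_iff_compactSpace.mp (wholeGroup X).isClosed'.isCompact
  have hinv : ((Measure.haarMeasure ⊤).map
      (Subgroup.subtype (wholeGroup X).toSubgroup)).IsMulLeftInvariant :=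
    isMulLeftInvariant_map (μ := Measure.haarMeasure ⊤)
      (Subgroup.subtype (wholeGroup X).toSubgroup).toMulHom measurable_subtype_coe
      fun x => ⟨⟨x, trivial⟩, rfl⟩
  refine Subtype.ext ?_
  have huniv : (subgroupHaar (wholeGroup X) : Measure X) Set.univ = 1 := measure_univ
  change (subgroupHaar (wholeGroup X) : Measure X).IsMulLeftInvariant at hinv
  have h := Measure.haarMeasure_unique (subgroupHaar (wholeGroup X) : Measure X) ⊤
  rw [TopologicalSpace.PositiveCompacts.coe_top, huniv, one_smul] at h
  exact h

/-- Images of Cesàro averages of convolution powers converge to Haar measure. -/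
theorem tendsto_map_convAverage [TopologicalSpace.MetrizableSpace X] {Γ : Type*} [Group Γ]
    [Countable Γ] [MeasurableSpace Γ] [DiscreteMeasurableSpace Γ] {p : Measure Γ}
    [IsProbabilityMeasure p] (hp : ∀ x, p {x} ≠ 0) (π : Γ →* X) {H : ClosedSubgroup X}
    (hH : (H : Set X) = closure (Set.range π)) :
    Tendsto (fun n => (convAverageProb p n).map (f := π) Measurable.of_discrete.aemeasurable) atTop
      (𝓝 (subgroupHaar H)) := by
  let _ := TopologicalSpace.metrizableSpaceMetric X
  have := isProbabilityMeasure_convAverage p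
  set ν : ℕ → ProbabilityMeasure X := fun n =>
    (convAverageProb p n).map (f := π) Measurable.of_discrete.aemeasurable with hν
  have hint : ∀ n (f : X → ℝ), Continuous f →
      ∫ x, f x ∂(ν n : Measure X) = ∫ γ, f (π γ) ∂convAverage p n := fun n f hf => by
    rw [hν, ProbabilityMeasure.toMeasure_map]
    exact integral_map Measurable.of_discrete.aemeasurable
      hf.measurable.stronglyMeasurable.aestronglyMeasurable
  have hπH : ∀ γ, π γ ∈ (H : Set X) := fun γ => hH ▸ subset_closure (Set.mem_range_self γ)
  -- The space of probability measures is compact, so it suffices to identify the limit `q` along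
  -- each ultrafilter.
  refine (tendsto_iff_ultrafilter _ _ _).2 fun u hu => ?_
  obtain ⟨q, -, hq⟩ := isCompact_univ.ultrafilter_le_nhds (u.map ν) (by simp)
  have hq' : Tendsto ν u (𝓝 q) := hq
  suffices q = subgroupHaar H from this ▸ hq'
  have hqint : ∀ f : C(X, ℝ), Tendsto (fun n => ∫ γ, f (π γ) ∂convAverage p n) u
      (𝓝 (∫ x, f x ∂(q : Measure X))) := fun f =>
    (tendsto_integral_of_tendsto hq' f).congr fun n => hint n f f.continuous
  -- Stationarity of `q` under a right step of the walk. It makes the function `Φ` below harmonic.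
  have hharm : ∀ f : C(X, ℝ),
      ∫ x, ∫ γ, f (x * π γ) ∂p ∂(q : Measure X) = ∫ x, f x ∂(q : Measure X) := by
    intro f
    obtain ⟨C, hC⟩ := exists_forall_norm_le_of_compactSpace f
    have hc : Continuous fun x => ∫ γ, f (x * π γ) ∂p :=
      continuous_of_dominated (bound := fun _ => C) (fun _ => AEStronglyMeasurable.of_discrete)
        (fun x => Eventually.of_forall fun γ => hC _) (integrable_const _)
        (Eventually.of_forall fun γ => by fun_prop)
    have h1 := (hqint ⟨_, hc⟩).sub (hqint f)
    have h2 := (tendsto_integral_convAverage_sub p (g := fun γ => f (π γ))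
      (fun γ => hC _)).mono_left hu
    simp only [map_mul] at h2
    exact sub_eq_zero.1 (tendsto_nhds_unique h1 h2)
  refine eq_subgroupHaar ?_ ?_
  · refine measure_eq_one_of_integral_infDist_eq_zero H.isClosed' ⟨1, H.one_mem⟩ ?_
    have h1 := hqint ⟨_, Metric.continuous_infDist_pt (H : Set X)⟩
    refine tendsto_nhds_unique h1 (tendsto_const_nhds.congr fun n => ?_)
    simp [Metric.infDist_zero_of_mem (hπH _)]
  · intro f
    obtain ⟨C, hC⟩ := exists_forall_norm_le_of_compactSpace f
    set Φ : X → ℝ := fun y => ∫ x, f (x * y) ∂(q : Measure X) with hΦ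
    have hΦc : Continuous Φ :=
      continuous_of_dominated (bound := fun _ => C)
        (fun y => (Continuous.measurable (by fun_prop)).stronglyMeasurable.aestronglyMeasurable)
        (fun x => Eventually.of_forall fun γ => hC _) (integrable_const _)
        (Eventually.of_forall fun γ => by fun_prop)
    have hΦC : ∀ y, ‖Φ y‖ ≤ C := fun y => norm_integral_le_of_forall_norm_le fun x => hC _
    have hΦm : ∀ y, ∫ γ, Φ (π γ * y) ∂p = Φ y := by
      intro y
      have h1 := hharm ⟨fun x => f (x * y), by fun_prop⟩
      simp only [ContinuousMap.coe_mk] at h1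
      show ∫ γ, ∫ x, f (x * (π γ * y)) ∂(q : Measure X) ∂p = ∫ x, f (x * y) ∂(q : Measure X)
      rw [← h1, integral_integral_swap]
      · simp only [mul_assoc]
      · refine Integrable.of_bound ?_ C (Eventually.of_forall fun x => hC _)
        refine (Measurable.stronglyMeasurable ?_).aestronglyMeasurable
        refine measurable_from_prod_countable_right fun γ => ?_
        exact Continuous.measurable (by fun_prop)
    -- Maximum principle on $H$: `Φ y₀` is the `p`-average of the values `Φ (π γ * y₀)`, none
    -- larger, and `p` charges every `γ`, so all are equal. Density of the range makes `Φ` constant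
    -- on $H$, which is right invariance of `q`.
    obtain ⟨y₀, hy₀, hmax⟩ := H.isClosed'.isCompact.exists_isMaxOn ⟨1, H.one_mem⟩ hΦc.continuousOn
    have heq : ∀ γ, Φ (π γ * y₀) = Φ y₀ := by
      have hle : ∀ γ, Φ (π γ * y₀) ≤ Φ y₀ := fun γ => hmax (H.mul_mem (hπH γ) hy₀)
      have hi : Integrable (fun γ => Φ (π γ * y₀)) p :=
        integrable_of_forall_norm_le fun γ => hΦC _
      have h0 : ∫ γ, (Φ y₀ - Φ (π γ * y₀)) ∂p = 0 := by
        rw [integral_sub (integrable_const _) hi, hΦm]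
        simp
      have h1 := (integral_eq_zero_iff_of_nonneg (fun γ => sub_nonneg.2 (hle γ))
        ((integrable_const _).sub hi)).1 h0
      intro γ
      by_contra hne
      refine hp γ (measure_mono_null (Set.singleton_subset_iff.2 ?_) h1)
      intro h2
      exact hne (sub_eq_zero.1 h2).symm
    have hclosed : IsClosed {x | Φ (x * y₀) = Φ y₀} :=
      isClosed_eq (by fun_prop) continuous_const
    have hall : (H : Set X) ⊆ {x | Φ (x * y₀) = Φ y₀} := by
      rw [hH]
      exact closure_minimal (by rintro _ ⟨γ, rfl⟩; exact heq γ) hclosed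
    have hconst : ∀ h ∈ H, Φ h = Φ y₀ := by
      intro h hh
      have h1 : Φ (h * y₀⁻¹ * y₀) = Φ y₀ := hall (H.mul_mem hh (H.inv_mem hy₀))
      rwa [inv_mul_cancel_right] at h1
    intro h hh
    have h1 : Φ h = Φ 1 := (hconst h hh).trans (hconst 1 H.one_mem).symm
    simpa [hΦ] using h1

end Haar

/-! ### Approximate equivariance on the finite sets and equivariance on the Loeb space -/

theorem exists_antitone_open_diagonal_basis (X : Type*) [TopologicalSpace X] [CompactSpace X]
    [TopologicalSpace.MetrizableSpace X] :
    ∃ U : ℕ → Set (X × X), Antitone U ∧ (∀ n, IsOpen (U n)) ∧ (∀ n, Set.diagonal X ⊆ U n) ∧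
      ∀ V, IsOpen V → Set.diagonal X ⊆ V → ∃ n, U n ⊆ V := by
  let _ := TopologicalSpace.metrizableSpaceMetric X
  refine ⟨fun n => {p | dist p.1 p.2 < 1 / ((n : ℝ) + 1)}, ?_, ?_, ?_, ?_⟩
  · intro m n hmn p hp
    have h : dist p.1 p.2 < _ := hp
    exact lt_of_lt_of_le h (Nat.one_div_le_one_div hmn)
  · exact fun n => isOpen_lt continuous_dist continuous_const
  · rintro n ⟨x, y⟩ (rfl : x = y)
    show dist x x < _
    rw [dist_self]
    positivity
  · intro V hV hdiag
    have h : V ∈ uniformity X := by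
      rw [← nhdsSet_diagonal_eq_uniformity]
      exact hV.mem_nhdsSet.2 hdiag
    obtain ⟨ε, hε, hεV⟩ := Metric.mem_uniformity_dist.1 h
    obtain ⟨n, hn⟩ := exists_nat_one_div_lt hε
    exact ⟨n, fun p hp => hεV (lt_trans hp hn)⟩

theorem tendsto_unif_one_iff {ω : Ultrafilter ℕ} {d : ℕ → ℕ} {A : ∀ k, Set (Fin (d k))} :
    Tendsto (fun k => unif (A k)) (ω : Filter ℕ) (𝓝 1) ↔
      ∀ ε : ℝ, 0 < ε → ∀ᶠ k in (ω : Filter ℕ), 1 - ε < unif (A k) := by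
  constructor
  · intro h ε hε
    exact h.eventually_const_lt (by linarith)
  · intro h
    refine tendsto_order.2 ⟨fun a ha => ?_, fun a ha => Eventually.of_forall fun k =>
      (unif_le_one _).trans_lt ha⟩
    filter_upwards [h (1 - a) (by linarith)] with k hk
    linarith

section Microstates

variable {G : Type*} [Group G] {X : Type*} [TopologicalSpace X] {ω : Ultrafilter ℕ} {d : ℕ → ℕ}

/-- The configurations which are equivariant under `g` up to `U`, at a proportion more than
`1 - ε` of the points. -/
def approxMicrostates [MulAction G X] (σ : ∀ k, G → Equiv.Perm (Fin (d k))) (k : ℕ) (g : G)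
    (U : Set (X × X)) (ε : ℝ) : Set (Fin (d k) → X) :=
  {φ | 1 - ε < unif {j | (φ (σ k g j), g • φ j) ∈ U}}

omit [TopologicalSpace X] in
theorem approxMicrostates_mono [MulAction G X] (σ : ∀ k, G → Equiv.Perm (Fin (d k))) (k : ℕ)
    (g : G) {U V : Set (X × X)} {ε δ : ℝ} (hUV : U ⊆ V) (hεδ : ε ≤ δ) :
    approxMicrostates σ k g U ε ⊆ approxMicrostates σ k g V δ := by
  intro φ hφ
  have h1 : 1 - ε < unif {j | (φ (σ k g j), g • φ j) ∈ U} := hφ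
  have h2 : unif {j | (φ (σ k g j), g • φ j) ∈ U} ≤ unif {j | (φ (σ k g j), g • φ j) ∈ V} :=
    unif_mono fun j hj => hUV hj
  show 1 - δ < unif {j | (φ (σ k g j), g • φ j) ∈ V}
  linarith

theorem measurableSet_approxMicrostates [MulAction G X] [ContinuousConstSMul G X]
    [SecondCountableTopology X] [MeasurableSpace X] [BorelSpace X]
    (σ : ∀ k, G → Equiv.Perm (Fin (d k))) (k : ℕ) (g : G) {U : Set (X × X)} (hU : IsOpen U)
    (ε : ℝ) : MeasurableSet (approxMicrostates σ k g U ε) := by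
  have h : approxMicrostates σ k g U ε = (fun φ : Fin (d k) → X =>
      {j | (φ (σ k g j), g • φ j) ∈ U}) ⁻¹' {J | 1 - ε < unif J} := rfl
  rw [h]
  refine measurableSet_preimage (measurable_set_iff.2 fun j => ?_) (Set.toFinite _).measurableSet
  have hm : Measurable fun φ : Fin (d k) → X => (φ (σ k g j), g • φ j) :=
    (measurable_pi_apply _).prodMk ((measurable_pi_apply j).const_smul g)
  exact hU.measurableSet.mem.comp hm

variable [∀ k, NeZero (d k)] (hω : ∀ s : Set ℕ, s.Finite → s ∉ ω)

include hω

theorem IsLift.comp_permAct {f : ∀ k, Fin (d k) → X} {F : LoebSpace ω d → X} (h : IsLift ω f F)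
    (p : ∀ k, Equiv.Perm (Fin (d k))) :
    IsLift ω (fun k j => f k (p k j)) (fun z => F (permAct ω p z)) := by
  filter_upwards [(measurePreserving_permAct hω p).quasiMeasurePreserving.ae h] with z hz
  rintro j rfl
  exact hz (fun k => p k (j k)) rfl

/-- If the limits of `φ k (σ k g j)` and `g • φ k j` were distinct, the complement of a product of
disjoint closed neighbourhoods would be a neighbourhood of the diagonal that the pairs eventually
leave. Countably many neighbourhoods `U n` keep the exceptional set null. -/
theorem IsLift.ae_equivariant_iff [CompactSpace X] [TopologicalSpace.MetrizableSpace X]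
    [MulAction G X] [ContinuousConstSMul G X] {σ : ∀ k, G → Equiv.Perm (Fin (d k))}
    {φ : ∀ k, Fin (d k) → X} {F : LoebSpace ω d → X} (h : IsLift ω φ F) (g : G) :
    (∀ᵐ z ∂loebMeasure ω d, F (permAct ω (fun k => σ k g) z) = g • F z) ↔
      ∀ U : Set (X × X), IsOpen U → Set.diagonal X ⊆ U → ∀ ε : ℝ, 0 < ε →
        ∀ᶠ k in (ω : Filter ℕ), φ k ∈ approxMicrostates σ k g U ε := by
  have h1 := h.comp_permAct hω fun k => σ k g
  constructor
  · intro hF U hU hdiag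
    refine tendsto_unif_one_iff.1 ((ae_mem_internalSet_iff hω _).1 ?_)
    filter_upwards [hF, h, h1] with z hz h2 h3
    obtain ⟨j, rfl⟩ := z.exists_rep
    rw [mk_mem_internalSet]
    have h4 := (h3 j rfl).prodMk_nhds ((h2 j rfl).const_smul g)
    exact h4 (hU.mem_nhds (hdiag hz))
  · intro hU
    obtain ⟨U, -, hUo, hUd, hUb⟩ := exists_antitone_open_diagonal_basis X
    have hall : ∀ n, ∀ᵐ z ∂loebMeasure ω d,
        z ∈ internalSet ω fun k => {j | (φ k (σ k g j), g • φ k j) ∈ U n} := fun n =>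
      (ae_mem_internalSet_iff hω _).2 (tendsto_unif_one_iff.2 (hU (U n) (hUo n) (hUd n)))
    filter_upwards [h, h1, ae_all_iff.2 hall] with z h2 h3 h4
    obtain ⟨j, rfl⟩ := z.exists_rep
    have h5 := (h3 j rfl).prodMk_nhds ((h2 j rfl).const_smul g)
    by_contra hne
    set a := F (permAct ω (fun k => σ k g) (LoebSpace.mk ω d j))
    set b := g • F (LoebSpace.mk ω d j)
    obtain ⟨V, W, hV, hW, haV, hbW, hVW⟩ := t2_separation hne
    obtain ⟨V', hV', haV', hVV'⟩ : ∃ V', IsClosed V' ∧ V' ∈ 𝓝 a ∧ V' ⊆ V := by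
      obtain ⟨t, ht, htc, htV⟩ := exists_mem_nhds_isClosed_subset (hV.mem_nhds haV)
      exact ⟨t, htc, ht, htV⟩
    obtain ⟨W', hW', hbW', hWW'⟩ : ∃ W', IsClosed W' ∧ W' ∈ 𝓝 b ∧ W' ⊆ W := by
      obtain ⟨t, ht, htc, htW⟩ := exists_mem_nhds_isClosed_subset (hW.mem_nhds hbW)
      exact ⟨t, htc, ht, htW⟩
    obtain ⟨n, hn⟩ := hUb (V' ×ˢ W')ᶜ (hV'.prod hW').isOpen_compl (by
      rintro ⟨x, y⟩ (rfl : x = y) hxy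
      exact Set.disjoint_left.1 hVW (hVV' hxy.1) (hWW' hxy.2))
    obtain ⟨k, hk1, hk2⟩ := ((mk_mem_internalSet.1 (h4 n)).and
      (h5 (prod_mem_nhds haV' hbW'))).exists
    exact hn hk1 hk2

omit [∀ k, NeZero (d k)] in
/-- If `μ` is asymptotically supported on topological microstates and the sets `B k` have
probability bounded below, then there is a microstate that is asymptotically in `B k`. -/
theorem AsympSupportedOnMicrostates.exists_mem [Countable G] [CompactSpace X]
    [TopologicalSpace.MetrizableSpace X] [MeasurableSpace X] [BorelSpace X]
    [MulAction G X] [ContinuousConstSMul G X] {σ : ∀ k, G → Equiv.Perm (Fin (d k))}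
    {μ : ∀ k, ProbabilityMeasure (Fin (d k) → X)} (hμ : AsympSupportedOnMicrostates σ ω μ)
    {B : ∀ k, Set (Fin (d k) → X)} {c : ℝ≥0∞} (hc : 0 < c)
    (hB : ∀ᶠ k in (ω : Filter ℕ), c ≤ (μ k : Measure (Fin (d k) → X)) (B k)) :
    ∃ φ : ∀ k, Fin (d k) → X, (∀ᶠ k in (ω : Filter ℕ), φ k ∈ B k) ∧
      ∀ (g : G) (U : Set (X × X)), IsOpen U → Set.diagonal X ⊆ U → ∀ ε : ℝ, 0 < ε →
        ∀ᶠ k in (ω : Filter ℕ), φ k ∈ approxMicrostates σ k g U ε := by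
  have : SecondCountableTopology X := by
    let _ := TopologicalSpace.metrizableSpaceMetric X
    infer_instance
  obtain ⟨e, he⟩ := exists_surjective_nat G
  obtain ⟨U, hUa, hUo, hUd, hUb⟩ := exists_antitone_open_diagonal_basis X
  have hR : ∀ n : ℕ, ∀ᶠ k in (ω : Filter ℕ), ∃ φ ∈ B k, ∀ i ∈ Finset.range (n + 1),
      φ ∈ approxMicrostates σ k (e i) (U n) (1 / ((n : ℝ) + 1)) := by
    intro n
    -- The total probability of violating the first $n+1$ conditions tends to zero, so it is
    -- eventually below `c` and cannot exhaust `B k`.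
    have hlim : Tendsto (fun k => ∑ i ∈ Finset.range (n + 1), (μ k : Measure (Fin (d k) → X))
        (approxMicrostates σ k (e i) (U n) (1 / ((n : ℝ) + 1)))ᶜ) (ω : Filter ℕ) (𝓝 0) := by
      rw [show (0 : ℝ≥0∞) = ∑ i ∈ Finset.range (n + 1), (1 - 1) by simp]
      refine tendsto_finsetSum _ fun i _ => ?_
      simp only [prob_compl_eq_one_sub (measurableSet_approxMicrostates σ _ (e i) (hUo n) _)]
      exact ENNReal.Tendsto.sub tendsto_const_nhds
        (hμ (e i) (U n) (hUo n) (hUd n) _ (by positivity)) (by simp)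
    filter_upwards [hB, hlim.eventually_lt_const hc] with k hk1 hk2
    by_contra hcon
    push Not at hcon
    refine absurd hk1 (not_le.2 (lt_of_le_of_lt ((measure_mono ?_).trans
      (measure_biUnion_finset_le (Finset.range (n + 1)) _)) hk2))
    intro φ hφ
    obtain ⟨i, hi, hi'⟩ := hcon φ hφ
    exact Set.mem_biUnion hi hi'
  obtain ⟨n, hn, hRn⟩ := exists_tendsto_level hω hR
  have hne : ∀ k, ∃ φ : Fin (d k) → X, (∃ φ ∈ B k, ∀ i ∈ Finset.range (n k + 1),
      φ ∈ approxMicrostates σ k (e i) (U (n k)) (1 / ((n k : ℝ) + 1))) →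
      φ ∈ B k ∧ ∀ i ∈ Finset.range (n k + 1),
      φ ∈ approxMicrostates σ k (e i) (U (n k)) (1 / ((n k : ℝ) + 1)) := by
    intro k
    by_cases h : ∃ φ ∈ B k, ∀ i ∈ Finset.range (n k + 1),
      φ ∈ approxMicrostates σ k (e i) (U (n k)) (1 / ((n k : ℝ) + 1))
    · obtain ⟨φ, hφ⟩ := h
      exact ⟨φ, fun _ => hφ⟩
    · obtain ⟨φ⟩ := (μ k).nonempty
      exact ⟨φ, fun h' => absurd h' h⟩
  choose φ hφ using hne
  refine ⟨φ, hRn.mono fun k hk => (hφ k hk).1, fun g V hV hVd ε hε => ?_⟩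
  obtain ⟨i, rfl⟩ := he g
  obtain ⟨N, hN⟩ := hUb V hV hVd
  obtain ⟨M, hM⟩ := exists_nat_one_div_lt hε
  filter_upwards [hRn, hn.eventually_ge_atTop i, hn.eventually_ge_atTop N,
    hn.eventually_ge_atTop M] with k hk h1 h2 h3
  exact approxMicrostates_mono σ k (e i) ((hUa h2).trans hN)
    ((Nat.one_div_le_one_div h3).trans hM.le)
    ((hφ k hk).2 i (Finset.mem_range.2 (Nat.lt_succ_iff.2 h1)))

end Microstates

/-! ### Absorbing maps carry all local limits -/

section Absorption

variable {G : Type*} [Group G] [Countable G] {X : Type*} [TopologicalSpace X] [CompactSpace X]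
  [TopologicalSpace.MetrizableSpace X] [MeasurableSpace X] [BorelSpace X] [Nonempty X]
  [MulAction G X] [ContinuousConstSMul G X]
  {ω : Ultrafilter ℕ} {d : ℕ → ℕ} [∀ k, NeZero (d k)]

omit [CompactSpace X] [TopologicalSpace.MetrizableSpace X] [Nonempty X] in
theorem integral_marginal {n : ℕ} (μ : ProbabilityMeasure (Fin n → X)) (j : Fin n) {f : X → ℝ}
    (hf : Continuous f) :
    ∫ x, f x ∂(marginal μ j : Measure X) = ∫ φ, f (φ j) ∂(μ : Measure (Fin n → X)) := by
  rw [marginal, ProbabilityMeasure.toMeasure_map]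
  exact integral_map (measurable_pi_apply j).aemeasurable
    hf.measurable.stronglyMeasurable.aestronglyMeasurable

omit [Countable G] [MeasurableSpace X] [BorelSpace X] in
theorem exists_isMicrostate_isLift (hω : ∀ s : Set ℕ, s.Finite → s ∉ ω)
    {σ : ∀ k, G → Equiv.Perm (Fin (d k))} {φ : ∀ k, Fin (d k) → X}
    (hφ : ∀ (g : G) (U : Set (X × X)), IsOpen U → Set.diagonal X ⊆ U → ∀ ε : ℝ, 0 < ε →
        ∀ᶠ k in (ω : Filter ℕ), φ k ∈ approxMicrostates σ k g U ε) :
    ∃ Θ : LoebSpace ω d →ₘ[loebMeasure ω d] X, IsMicrostate σ ω Θ ∧ IsLift ω φ Θ := by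
  have hlift := isLift_ultralimit (ω := ω) φ
  have hlift' : IsLift ω φ (AEEqFun.mk _ (aestronglyMeasurable_of_isLift hlift)) :=
    hlift.congr (AEEqFun.coeFn_mk _ _).symm
  exact ⟨_, fun g => (hlift'.ae_equivariant_iff hω g).2 (hφ g), hlift'⟩

/-- A set-valued map which absorbs all topological microstates supports all generalized local
limits of measures that are asymptotically supported on topological microstates. -/
theorem AbsorbsMicrostates.ae_measure_eq_one (hω : ∀ s : Set ℕ, s.Finite → s ∉ ω)
    {σ : ∀ k, G → Equiv.Perm (Fin (d k))}
    {μ : ∀ k, ProbabilityMeasure (Fin (d k) → X)} (hμ : AsympSupportedOnMicrostates σ ω μ)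
    {m : LoebSpace ω d → ProbabilityMeasure X} (hm : IsLift ω (fun k => marginal (μ k)) m)
    {K : LoebSpace ω d → TopologicalSpace.NonemptyCompacts X}
    (hK : AEStronglyMeasurable K (loebMeasure ω d))
    (habs : AbsorbsMicrostates σ ω fun z => (K z : Set X)) :
    ∀ᵐ z ∂loebMeasure ω d, (m z : Measure X) (K z) = 1 := by
  let _ := TopologicalSpace.metrizableSpaceMetric X
  obtain ⟨κ, hκ⟩ := exists_isLift hω hK
  set D := Metric.diam (Set.univ : Set X) with hD
  have hD0 : 0 ≤ D := Metric.diam_nonneg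
  have hr0 : ∀ k j x, 0 ≤ Metric.infDist x (κ k j : Set X) := fun _ _ _ => Metric.infDist_nonneg
  have hrD : ∀ k j x, Metric.infDist x (κ k j : Set X) ≤ D := fun k j x => by
    obtain ⟨y, hy⟩ := (κ k j).nonempty
    exact (Metric.infDist_le_dist_of_mem hy).trans
      (Metric.dist_le_diam_of_mem isCompact_univ.isBounded trivial trivial)
  have hd : ∀ k, (0 : ℝ) < d k := fun k => by exact_mod_cast Nat.pos_of_ne_zero (NeZero.ne (d k))
  set f : ∀ k, (Fin (d k) → X) → ℝ := fun k φ =>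
    (∑ j, Metric.infDist (φ j) (κ k j : Set X)) / d k with hf
  have hfc : ∀ k, Continuous (f k) := fun k => by
    refine Continuous.div_const (continuous_finsetSum _ fun j _ => ?_) _
    exact (Metric.continuous_infDist_pt _).comp (continuous_apply j)
  have hfD : ∀ k φ, f k φ ≤ D := fun k φ => by
    rw [hf, div_le_iff₀ (hd k)]
    refine (Finset.sum_le_sum fun j _ => hrD k j _).trans (le_of_eq ?_)
    simp [mul_comm]
  have hf0 : ∀ k φ, 0 ≤ f k φ := fun k φ =>
    div_nonneg (Finset.sum_nonneg fun j _ => hr0 k j _) (hd k).le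
  have hint : Tendsto (fun k => ∫ φ, f k φ ∂(μ k : Measure (Fin (d k) → X))) (ω : Filter ℕ)
      (𝓝 0) := by
    refine Metric.tendsto_nhds.2 fun ε hε => ?_
    by_contra hcon
    rw [← Ultrafilter.eventually_not] at hcon
    -- From $\varepsilon\le\int f\le\varepsilon/2+D\,\mu_k(f\ge\varepsilon/2)$; using $D+1$ avoids
    -- dividing by zero when $X$ is a point.
    have hB : ∀ᶠ k in (ω : Filter ℕ), ENNReal.ofReal (ε / 2 / (D + 1)) ≤
        (μ k : Measure (Fin (d k) → X)) {φ | ε / 2 ≤ f k φ} := by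
      filter_upwards [hcon] with k hk
      rw [Real.dist_eq, sub_zero, abs_of_nonneg (integral_nonneg (hf0 k)), not_lt] at hk
      have hmeas : MeasurableSet {φ | ε / 2 ≤ f k φ} :=
        (isClosed_le continuous_const (hfc k)).measurableSet
      have h1 : ∫ φ, f k φ ∂(μ k : Measure (Fin (d k) → X)) ≤
          ∫ φ, (ε / 2 + {φ | ε / 2 ≤ f k φ}.indicator (fun _ => D) φ)
            ∂(μ k : Measure (Fin (d k) → X)) := by
        refine integral_mono (integrable_of_continuous _ (hfc k))
          ((integrable_const _).add ((integrable_const _).indicator hmeas)) fun φ => ?_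
        by_cases hφ : ε / 2 ≤ f k φ
        · have h2 : {φ | ε / 2 ≤ f k φ}.indicator (fun _ => D) φ = D :=
            Set.indicator_of_mem (s := {φ | ε / 2 ≤ f k φ}) hφ _
          rw [h2]
          linarith [hfD k φ]
        · have h2 : {φ | ε / 2 ≤ f k φ}.indicator (fun _ => D) φ = 0 :=
            Set.indicator_of_notMem (s := {φ | ε / 2 ≤ f k φ}) hφ _
          rw [h2]
          linarith
      rw [integral_add (integrable_const _) ((integrable_const _).indicator hmeas),
        integral_indicator_const _ hmeas] at h1
      simp only [integral_const, probReal_univ, smul_eq_mul] at h1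
      refine ENNReal.ofReal_le_of_le_toReal ?_
      change _ ≤ (μ k : Measure (Fin (d k) → X)).real {φ | ε / 2 ≤ f k φ}
      rw [div_le_iff₀ (by linarith)]
      nlinarith [measureReal_nonneg (μ := (μ k : Measure (Fin (d k) → X)))
        (s := {φ | ε / 2 ≤ f k φ})]
    -- One microstate with average distance at least $\varepsilon/2$ from the lifted sets.
    -- Absorption makes its distance vanish a.e. in the limit, hence on average, a contradiction.
    obtain ⟨φ, hφB, hφ⟩ := hμ.exists_mem hω (ENNReal.ofReal_pos.2 (by positivity)) hB
    obtain ⟨Θ, hΘ, hφΘ⟩ := exists_isMicrostate_isLift hω hφ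
    have hlift : IsLift ω (fun k j => Metric.infDist (φ k j) (κ k j : Set X)) (fun _ => 0) := by
      filter_upwards [hφΘ, hκ, habs Θ hΘ] with z h1 h2 h3 j hj
      have h4 := (Metric.lipschitz_infDist (α := X)).continuous.tendsto
        (Θ z, K z)
      have h5 := h4.comp ((h1 j hj).prodMk_nhds (h2 j hj))
      rwa [Metric.infDist_zero_of_mem h3] at h5
    have havg := (isLift_zero_iff hω (fun k j => hr0 k j _) (fun k j => hrD k j _)).1 hlift
    obtain ⟨k, hk1, hk2⟩ := (hφB.and (havg.eventually_lt_const (half_pos hε))).exists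
    exact absurd hk1 (not_le.2 hk2)
  have hmarg : IsLift ω (fun k j =>
      ∫ x, Metric.infDist x (κ k j : Set X) ∂(marginal (μ k) j : Measure X)) (fun _ => 0) := by
    refine (isLift_zero_iff hω (C := D) (fun k j => integral_nonneg (hr0 k j)) fun k j => ?_).2 ?_
    · refine (le_abs_self _).trans (norm_integral_le_of_forall_norm_le fun x => ?_)
      rw [Real.norm_of_nonneg (hr0 _ _ _)]
      exact hrD _ _ _
    · refine hint.congr fun k => ?_
      simp only [hf, integral_marginal (μ k) _ (Metric.continuous_infDist_pt _)]
      rw [integral_div, integral_finsetSum]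
      exact fun j _ => integrable_of_continuous _
        ((Metric.continuous_infDist_pt _).comp (continuous_apply j))
  filter_upwards [hmarg, hm, hκ] with z h1 h2 h3
  obtain ⟨j, hj⟩ := z.exists_rep
  refine measure_eq_one_of_integral_infDist_eq_zero (K z).isCompact.isClosed (K z).nonempty ?_
  have h4 := tendsto_integral_of_tendsto (h2 j hj)
    ⟨_, Metric.continuous_infDist_pt (K z : Set X)⟩
  have h5 : Tendsto (fun k => dist (κ k (j k)) (K z)) (ω : Filter ℕ) (𝓝 0) :=
    tendsto_iff_dist_tendsto_zero.1 (h3 j hj)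
  refine tendsto_nhds_unique h4 ?_
  have h6 := (h1 j hj).add h5
  rw [add_zero] at h6
  refine squeeze_zero (fun k => integral_nonneg fun x => Metric.infDist_nonneg) (fun k => ?_) h6
  -- The distance to a set is 1-Lipschitz in the Hausdorff metric, so the lift `κ k (j k)` may be
  -- replaced by its limit `K z`.
  have h7 : ∫ x, Metric.infDist x (K z : Set X) ∂(marginal (μ k) (j k) : Measure X) ≤
      ∫ x, (Metric.infDist x (κ k (j k) : Set X) + dist (κ k (j k)) (K z))
        ∂(marginal (μ k) (j k) : Measure X) := by
    refine integral_mono (integrable_of_continuous _ (Metric.continuous_infDist_pt _))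
      (integrable_of_continuous _ ((Metric.continuous_infDist_pt _).add continuous_const))
      fun x => ?_
    have h8 := (Metric.lipschitz_infDist_set x).dist_le_mul (K z)
      (κ k (j k))
    rw [NNReal.coe_one, one_mul, Real.dist_eq, dist_comm] at h8
    linarith [le_abs_self (Metric.infDist x (K z : Set X) - Metric.infDist x (κ k (j k) : Set X))]
  refine h7.trans (le_of_eq ?_)
  rw [integral_add (integrable_of_continuous _ (Metric.continuous_infDist_pt _))
    (integrable_const _)]
  simp

end Absorption

/-! ### Countable dense families and measurability of subgroup-valued maps -/

/-- A family of measurable maps to a second countable space has a countable subfamily whose values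
are almost everywhere dense among the values of each map of the family. -/
theorem exists_countable_ae_mem_closure {Z X : Type*} [MeasurableSpace Z] {μ : Measure Z}
    [IsFiniteMeasure μ] [TopologicalSpace X] [SecondCountableTopology X]
    [TopologicalSpace.PseudoMetrizableSpace X] (S : Set (Z → X))
    (hS : ∀ F ∈ S, AEStronglyMeasurable F μ) :
    ∃ C ⊆ S, C.Countable ∧ ∀ F ∈ S, ∀ᵐ z ∂μ, F z ∈ closure ((fun F' : Z → X => F' z) '' C) := by
  borelize X
  have key : ∀ U : Set X, IsOpen U → ∃ C ⊆ S, C.Countable ∧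
      ∀ F ∈ S, ∀ᵐ z ∂μ, F z ∈ U → ∃ F' ∈ C, F' z ∈ U := by
    intro U hU
    have hnull : ∀ C ⊆ S, C.Countable → NullMeasurableSet (⋃ F ∈ C, F ⁻¹' U) μ := fun C hC hCc =>
      NullMeasurableSet.biUnion hCc fun F hF =>
        (hS F (hC hF)).aemeasurable.nullMeasurable hU.measurableSet
    -- Exhaustion: a countable union of nearly optimal subfamilies attains the supremum of these
    -- measures, so adding any further `F` enlarges the union only by a null set. This is then done
    -- for each `U` in a countable basis.
    let V : Set ℝ≥0∞ := {v | ∃ C ⊆ S, C.Countable ∧ v = μ (⋃ F ∈ C, F ⁻¹' U)}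
    obtain ⟨u, -, hu, huV⟩ := exists_seq_tendsto_sSup (S := V)
      ⟨_, ∅, Set.empty_subset _, Set.countable_empty, rfl⟩ (OrderTop.bddAbove _)
    choose C hCS hCc hCu using huV
    have hCS' : ⋃ n, C n ⊆ S := Set.iUnion_subset hCS
    have hCc' : (⋃ n, C n).Countable := Set.countable_iUnion hCc
    refine ⟨⋃ n, C n, hCS', hCc', fun F hF => ?_⟩
    have hsup : sSup V ≤ μ (⋃ F ∈ ⋃ n, C n, F ⁻¹' U) := by
      refine le_of_tendsto' hu fun n => ?_
      rw [hCu n]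
      exact measure_mono (Set.biUnion_subset_biUnion_left (Set.subset_iUnion C n))
    have hle : μ (⋃ F' ∈ insert F (⋃ n, C n), F' ⁻¹' U) ≤ μ (⋃ F ∈ ⋃ n, C n, F ⁻¹' U) :=
      (le_sSup (show _ ∈ V from ⟨_, Set.insert_subset hF hCS', hCc'.insert F, rfl⟩)).trans hsup
    rw [Set.biUnion_insert] at hle
    have h0 : μ (F ⁻¹' U \ ⋃ F ∈ ⋃ n, C n, F ⁻¹' U) = 0 := by
      have h1 := measure_inter_add_sdiff₀ (F ⁻¹' U ∪ ⋃ F ∈ ⋃ n, C n, F ⁻¹' U)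
        (hnull _ hCS' hCc')
      rw [Set.union_sdiff_right, Set.inter_eq_self_of_subset_right Set.subset_union_right] at h1
      rw [← h1] at hle
      by_contra hne
      exact absurd hle (not_le.2 (ENNReal.lt_add_right (measure_ne_top _ _) hne))
    filter_upwards [measure_eq_zero_iff_ae_notMem.1 h0] with z hz hzU
    by_contra hcon
    refine hz ⟨hzU, fun h => hcon ?_⟩
    obtain ⟨F', hF', hF'z⟩ := Set.mem_iUnion₂.1 h
    exact ⟨F', hF', hF'z⟩
  choose! C hCS hCc hC using key
  have hB := TopologicalSpace.isBasis_countableBasis X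
  refine ⟨⋃ U ∈ TopologicalSpace.countableBasis X, C U, ?_, ?_, fun F hF => ?_⟩
  · exact Set.iUnion₂_subset fun U hU => hCS U (hB.isOpen hU)
  · exact (TopologicalSpace.countable_countableBasis X).biUnion fun U hU => hCc U (hB.isOpen hU)
  · have hall := (ae_ball_iff (TopologicalSpace.countable_countableBasis X)).2
      fun U hU => hC U (hB.isOpen hU) F hF
    filter_upwards [hall] with z hz
    refine hB.mem_closure_iff.2 fun U hU hzU => ?_
    obtain ⟨F', hF', hF'U⟩ := hz U hU hzU
    exact ⟨F' z, hF'U, F', Set.mem_biUnion hU hF', rfl⟩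

section Hyperspace

/-- The closure of the range of a sequence in a compact space. -/
def closureRange {X ι : Type*} [TopologicalSpace X] [CompactSpace X] [Nonempty ι] (x : ι → X) :
    TopologicalSpace.NonemptyCompacts X :=
  ⟨⟨closure (Set.range x), isClosed_closure.isCompact⟩, (Set.range_nonempty x).closure⟩

/-- The finite set of the first `n + 1` terms of a sequence. -/
def initialPoints {X : Type*} [TopologicalSpace X] (x : ℕ → X) :
    ℕ → TopologicalSpace.NonemptyCompacts X
  | 0 => {x 0}
  | n + 1 => initialPoints x n ⊔ {x (n + 1)}

theorem mem_initialPoints {X : Type*} [TopologicalSpace X] {x : ℕ → X} {n : ℕ} {y : X} :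
    y ∈ initialPoints x n ↔ ∃ i ≤ n, x i = y := by
  induction n with
  | zero => simp [initialPoints, eq_comm]
  | succ n ih =>
    rw [initialPoints, ← SetLike.mem_coe, TopologicalSpace.NonemptyCompacts.coe_sup,
      Set.mem_union, SetLike.mem_coe, ih]
    constructor
    · rintro (⟨i, hi, rfl⟩ | h)
      · exact ⟨i, hi.trans n.le_succ, rfl⟩
      · exact ⟨n + 1, le_rfl, Eq.symm h⟩
    · rintro ⟨i, hi, rfl⟩
      rcases Nat.le_succ_iff.1 hi with hi | rfl
      · exact Or.inl ⟨i, hi, rfl⟩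
      · exact Or.inr rfl

theorem tendsto_initialPoints {X : Type*} [MetricSpace X] [CompactSpace X] (x : ℕ → X) :
    Tendsto (initialPoints x) atTop (𝓝 (closureRange x)) := by
  refine Metric.tendsto_atTop.2 fun ε hε => ?_
  have hcover : (closure (Set.range x)) ⊆ ⋃ i, Metric.ball (x i) (ε / 2) := by
    intro y hy
    obtain ⟨_, ⟨i, rfl⟩, hi⟩ := Metric.mem_closure_iff.1 hy (ε / 2) (half_pos hε)
    exact Set.mem_iUnion.2 ⟨i, hi⟩
  obtain ⟨t, ht⟩ := isClosed_closure.isCompact.elim_finite_subcover _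
    (fun i => Metric.isOpen_ball) hcover
  refine ⟨t.sup id, fun n hn => ?_⟩
  rw [Metric.NonemptyCompacts.dist_eq]
  refine lt_of_le_of_lt (Metric.hausdorffDist_le_of_mem_dist (half_pos hε).le ?_ ?_)
    (half_lt_self hε)
  · intro y hy
    obtain ⟨i, -, rfl⟩ := mem_initialPoints.1 hy
    exact ⟨x i, subset_closure (Set.mem_range_self i), by simpa using (half_pos hε).le⟩
  · intro y hy
    obtain ⟨i, hi, hyi⟩ := Set.mem_iUnion₂.1 (ht hy)
    exact ⟨x i, mem_initialPoints.2 ⟨i, (Finset.le_sup (f := id) hi).trans hn, rfl⟩,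
      (Metric.mem_ball.1 hyi).le⟩

/-- In the Hausdorff metric the closure is the limit of the finite sets of initial points, which
depend continuously on those points through singletons and unions. -/
theorem aestronglyMeasurable_closureRange {Z X : Type*} [MeasurableSpace Z] {μ : Measure Z}
    [TopologicalSpace X] [CompactSpace X] [TopologicalSpace.MetrizableSpace X]
    {x : ℕ → Z → X} (hx : ∀ i, AEStronglyMeasurable (x i) μ) :
    AEStronglyMeasurable (fun z => closureRange fun i => x i z) μ := by
  let _ := TopologicalSpace.metrizableSpaceMetric X
  have h : ∀ n, AEStronglyMeasurable (fun z => initialPoints (fun i => x i z) n) μ := by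
    intro n
    induction n with
    | zero =>
      exact (TopologicalSpace.NonemptyCompacts.isometry_singleton (α := X)).continuous
        |>.comp_aestronglyMeasurable (hx 0)
    | succ n ih =>
      exact (TopologicalSpace.NonemptyCompacts.lipschitz_sup (α := X)).continuous
        |>.comp_aestronglyMeasurable (ih.prodMk
          ((TopologicalSpace.NonemptyCompacts.isometry_singleton (α := X)).continuous
            |>.comp_aestronglyMeasurable (hx (n + 1))))
  exact aestronglyMeasurable_of_tendsto_ae atTop h
    (Eventually.of_forall fun z => tendsto_initialPoints _)

variable {X : Type*} [Group X] [TopologicalSpace X] [IsTopologicalGroup X] [CompactSpace X]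

/-- A closed subgroup of a compact group, as a nonempty compact set. -/
def subgroupCompacts (H : ClosedSubgroup X) : TopologicalSpace.NonemptyCompacts X :=
  ⟨⟨(H : Set X), H.isClosed'.isCompact⟩, ⟨1, H.one_mem⟩⟩

omit [IsTopologicalGroup X] in
theorem coe_subgroupCompacts (H : ClosedSubgroup X) : (subgroupCompacts H : Set X) = H := rfl

omit [IsTopologicalGroup X] in
theorem isEmbedding_subgroupCompacts : IsEmbedding (subgroupCompacts (X := X)) := by
  refine ⟨⟨rfl⟩, fun H K h => SetLike.coe_injective ?_⟩
  exact congrArg (fun L : TopologicalSpace.NonemptyCompacts X => (L : Set X)) h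

omit [IsTopologicalGroup X] in
theorem pseudoMetrizableSpace_closedSubgroup [TopologicalSpace.MetrizableSpace X] :
    TopologicalSpace.PseudoMetrizableSpace (ClosedSubgroup X) := by
  let _ := TopologicalSpace.metrizableSpaceMetric X
  exact isEmbedding_subgroupCompacts.isInducing.pseudoMetrizableSpace

omit [IsTopologicalGroup X] in
theorem aestronglyMeasurable_subgroupCompacts_iff [TopologicalSpace.MetrizableSpace X]
    {Z : Type*} [MeasurableSpace Z] {μ : Measure Z} {H : Z → ClosedSubgroup X} :
    AEStronglyMeasurable (fun z => subgroupCompacts (H z)) μ ↔ AEStronglyMeasurable H μ := by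
  let _ := TopologicalSpace.metrizableSpaceMetric X
  have := pseudoMetrizableSpace_closedSubgroup (X := X)
  exact isEmbedding_subgroupCompacts.aestronglyMeasurable_comp_iff

/-- The closure of the range of a homomorphism to a topological group. -/
def closedRange {Γ : Type*} [Group Γ] (π : Γ →* X) : ClosedSubgroup X :=
  ⟨π.range.topologicalClosure, π.range.isClosed_topologicalClosure⟩

omit [CompactSpace X] in
theorem coe_closedRange {Γ : Type*} [Group Γ] (π : Γ →* X) :
    (closedRange π : Set X) = closure (Set.range π) := by
  rw [← MonoidHom.coe_range, ← Subgroup.topologicalClosure_coe]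
  rfl

theorem aestronglyMeasurable_closedRange [TopologicalSpace.MetrizableSpace X]
    {Z : Type*} [MeasurableSpace Z] {μ : Measure Z} {Γ : Type*} [Group Γ] [Countable Γ]
    {π : Z → Γ →* X} (hπ : ∀ γ, AEStronglyMeasurable (fun z => π z γ) μ) :
    AEStronglyMeasurable (fun z => closedRange (π z)) μ := by
  obtain ⟨e, he⟩ := exists_surjective_nat Γ
  refine aestronglyMeasurable_subgroupCompacts_iff.1 ?_
  refine (aestronglyMeasurable_closureRange fun i => hπ (e i)).congr
    (Eventually.of_forall fun z => SetLike.coe_injective ?_)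
  rw [coe_subgroupCompacts, coe_closedRange]
  exact congrArg closure (he.range_comp (π z))

end Hyperspace

/-! ### The group of microstates -/

section MicrostateGroup

variable {G : Type*} [Group G] {X : Type*} [Group X] [TopologicalSpace X] [IsTopologicalGroup X]
  [MulDistribMulAction G X] {ω : Ultrafilter ℕ} {d : ℕ → ℕ}

/-- The pointwise group of measurable almost surely equivariant maps. -/
def microstateGroup (X : Type*) [Group X] [TopologicalSpace X] [IsTopologicalGroup X]
    [MulDistribMulAction G X] (σ : ∀ k, G → Equiv.Perm (Fin (d k))) (ω : Ultrafilter ℕ) :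
    Subgroup (LoebSpace ω d → X) where
  carrier := {F | AEStronglyMeasurable F (loebMeasure ω d) ∧
    ∀ g : G, ∀ᵐ z ∂loebMeasure ω d, F (permAct ω (fun k => σ k g) z) = g • F z}
  mul_mem' := by
    rintro F F' ⟨hF, hFe⟩ ⟨hF', hFe'⟩
    refine ⟨hF.mul hF', fun g => ?_⟩
    filter_upwards [hFe g, hFe' g] with z h1 h2
    rw [Pi.mul_apply, Pi.mul_apply, h1, h2, smul_mul']
  one_mem' := ⟨aestronglyMeasurable_one, fun g => Eventually.of_forall fun z => (smul_one g).symm⟩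
  inv_mem' := by
    rintro F ⟨hF, hFe⟩
    refine ⟨hF.inv, fun g => ?_⟩
    filter_upwards [hFe g] with z h1
    rw [Pi.inv_apply, Pi.inv_apply, h1, smul_inv']

variable {σ : ∀ k, G → Equiv.Perm (Fin (d k))}

theorem IsMicrostate.coeFn_mem_microstateGroup {Θ : LoebSpace ω d →ₘ[loebMeasure ω d] X}
    (hΘ : IsMicrostate σ ω Θ) : (Θ : LoebSpace ω d → X) ∈ microstateGroup X σ ω :=
  ⟨Θ.aestronglyMeasurable, hΘ⟩

theorem isMicrostate_mk [∀ k, NeZero (d k)] (hω : ∀ s : Set ℕ, s.Finite → s ∉ ω)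
    {F : LoebSpace ω d → X} (hF : F ∈ microstateGroup X σ ω) :
    IsMicrostate σ ω (AEEqFun.mk F hF.1) := by
  intro g
  have h := AEEqFun.coeFn_mk F hF.1
  filter_upwards [hF.2 g, h, (measurePreserving_permAct hω
    fun k => σ k g).quasiMeasurePreserving.ae h] with z h1 h2 h3
  rw [h2, h3, h1]

end MicrostateGroup

/-! ### Random microstates realizing Haar measures -/

theorem marginal_map {X : Type*} [MeasurableSpace X] {Γ : Type*}
    [MeasurableSpace Γ] [DiscreteMeasurableSpace Γ] {n : ℕ}
    (κ : ProbabilityMeasure Γ) (φ : Γ → Fin n → X) (j : Fin n) :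
    marginal (κ.map (f := φ) Measurable.of_discrete.aemeasurable) j =
      κ.map (f := fun γ => φ γ j) Measurable.of_discrete.aemeasurable := by
  refine Subtype.ext ?_
  change Measure.map (fun φ : Fin n → X => φ j) (Measure.map φ (κ : Measure Γ)) =
    Measure.map (fun γ => φ γ j) (κ : Measure Γ)
  rw [Measure.map_map (measurable_pi_apply j) Measurable.of_discrete]
  rfl

theorem tendsto_map_of_forall_tendsto {X : Type*} [TopologicalSpace X] [MeasurableSpace X]
    [BorelSpace X] {Γ : Type*} [Countable Γ] [MeasurableSpace Γ]
    [DiscreteMeasurableSpace Γ] {ι : Type*} {l : Filter ι} (κ : ProbabilityMeasure Γ)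
    {f : ι → Γ → X} {F : Γ → X} (h : ∀ γ, Tendsto (fun i => f i γ) l (𝓝 (F γ))) :
    Tendsto (fun i => κ.map (f := f i) Measurable.of_discrete.aemeasurable) l
      (𝓝 (κ.map (f := F) Measurable.of_discrete.aemeasurable)) := by
  refine ProbabilityMeasure.tendsto_iff_forall_integral_tendsto.2 fun u => ?_
  have hmap : ∀ g : Γ → X, ∫ x, u x ∂(κ.map (f := g) Measurable.of_discrete.aemeasurable :
      Measure X) = ∫ γ, u (g γ) ∂(κ : Measure Γ) := fun g => by
    rw [ProbabilityMeasure.toMeasure_map]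
    exact integral_map Measurable.of_discrete.aemeasurable
      u.continuous.measurable.stronglyMeasurable.aestronglyMeasurable
  simp only [hmap]
  exact tendsto_integral_of_forall_tendsto (C := ‖u‖) (fun i γ => u.norm_coe_le_norm _)
    (fun γ => u.norm_coe_le_norm _) fun γ => (u.continuous.tendsto _).comp (h γ)

section RandomMicrostates

variable {G : Type*} [Group G] [Countable G] {X : Type*} [Group X] [TopologicalSpace X]
  [IsTopologicalGroup X] [CompactSpace X] [TopologicalSpace.MetrizableSpace X]
  [MeasurableSpace X] [BorelSpace X] [MulDistribMulAction G X] [ContinuousConstSMul G X]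
  {ω : Ultrafilter ℕ} {d : ℕ → ℕ} [∀ k, NeZero (d k)]
  {σ : ∀ k, G → Equiv.Perm (Fin (d k))}

/-- Evaluation at a point of a homomorphism to a group of functions. -/
def evalHom {Γ Z X : Type*} [Group Γ] [Group X] (π : Γ →* (Z → X)) (z : Z) : Γ →* X :=
  (Pi.evalMonoidHom (fun _ : Z => X) z).comp π

/-- Haar measure of the closed subgroup generated by countably many topological microstates is a
generalized local limit. -/
theorem isGeneralizedLocalLimit_closedRange (hω : ∀ s : Set ℕ, s.Finite → s ∉ ω)
    {Γ : Type*} [Group Γ] [Countable Γ] (π : Γ →* (LoebSpace ω d → X))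
    (hπ : ∀ γ, π γ ∈ microstateGroup X σ ω) :
    IsGeneralizedLocalLimit σ ω fun z => subgroupHaar (closedRange (evalHom π z)) := by
  let _ : MeasurableSpace Γ := ⊤
  have : DiscreteMeasurableSpace Γ := ⟨fun _ => trivial⟩
  have := isProbabilityMeasure_loebMeasure (d := d) hω
  have hne : Nonempty (ProbabilityMeasure X) := ⟨diracProba 1⟩
  let _ := TopologicalSpace.metrizableSpaceMetric (ProbabilityMeasure X)
  obtain ⟨p, hp, hp0⟩ := exists_isProbabilityMeasure_forall_singleton_ne_zero (Γ := Γ)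
  obtain ⟨e, he⟩ := exists_surjective_nat G
  obtain ⟨U, hUa, hUo, hUd, hUb⟩ := exists_antitone_open_diagonal_basis X
  choose φ hφ using fun γ => exists_isLift hω (hπ γ).1
  have hφm : ∀ γ (g : G) (V : Set (X × X)), IsOpen V → Set.diagonal X ⊆ V → ∀ ε : ℝ, 0 < ε →
      ∀ᶠ k in (ω : Filter ℕ), φ γ k ∈ approxMicrostates σ k g V ε := fun γ g =>
    ((hφ γ).ae_equivariant_iff hω g).1 ((hπ γ).2 g)
  -- The law of the lifted microstate `φ γ k`, and below it that of the value `π γ z`, when `γ` is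
  -- drawn from the $n$-th Cesàro average.
  let μ : ℕ → ∀ k, ProbabilityMeasure (Fin (d k) → X) := fun n k =>
    (convAverageProb p n).map (f := fun γ => φ γ k) Measurable.of_discrete.aemeasurable
  let F : ℕ → LoebSpace ω d → ProbabilityMeasure X := fun n z =>
    (convAverageProb p n).map (f := evalHom π z) Measurable.of_discrete.aemeasurable
  have hF : ∀ n, IsLift ω (fun k => marginal (μ n k)) (F n) := by
    intro n
    filter_upwards [ae_all_iff.2 hφ] with z hz j hj
    simp only [μ, marginal_map]
    exact tendsto_map_of_forall_tendsto _ fun γ => hz γ j hj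
  have hlim : ∀ z, Tendsto (fun n => F n z) atTop
      (𝓝 (subgroupHaar (closedRange (evalHom π z)))) := fun z =>
    tendsto_map_convAverage hp0 (evalHom π z) (coe_closedRange _)
  have hμ : ∀ n (g : G) (V : Set (X × X)), IsOpen V → Set.diagonal X ⊆ V → ∀ ε : ℝ, 0 < ε →
      Tendsto (fun k => (μ n k : Measure (Fin (d k) → X)) (approxMicrostates σ k g V ε))
        (ω : Filter ℕ) (𝓝 1) := by
    classical
    intro n g V hV hVd ε hε
    set S : ℕ → Set Γ := fun k => {γ | φ γ k ∈ approxMicrostates σ k g V ε} with hS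
    have hsc : SecondCountableTopology X := by
      let _ := TopologicalSpace.metrizableSpaceMetric X
      infer_instance
    have hmap : ∀ k, (μ n k : Measure (Fin (d k) → X)) (approxMicrostates σ k g V ε) =
        (convAverageProb p n : Measure Γ) (S k) := fun k => by
      simp only [μ, ProbabilityMeasure.toMeasure_map]
      exact Measure.map_apply Measurable.of_discrete
        (measurableSet_approxMicrostates σ k g hV ε)
    -- Each fixed `γ` eventually lies in `S k`; dominated convergence over `Γ` gives that `S k` has
    -- probability tending to one.
    have h1 := tendsto_integral_of_forall_tendsto (l := (ω : Filter ℕ)) (C := 1)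
      (κ := (convAverageProb p n : Measure Γ)) (h := fun k => (S k).indicator (fun _ => (1 : ℝ)))
      (g := fun _ => 1) (fun k γ => by
        by_cases h : γ ∈ S k <;> simp [h]) (fun _ => by simp) (fun γ => by
        refine tendsto_const_nhds.congr' ?_
        filter_upwards [hφm γ g V hV hVd ε hε] with k hk
        exact (Set.indicator_of_mem (s := S k) (a := γ) hk fun _ => (1 : ℝ)).symm)
    simp only [integral_indicator_const _ (MeasurableSet.of_discrete (s := S _)), smul_eq_mul,
      mul_one, integral_const, probReal_univ] at h1
    have h2 := ENNReal.tendsto_ofReal h1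
    simpa [hmap] using h2
  -- Let $n$ grow slowly with $k$: the marginals then lift the Haar limit, while `R` retains
  -- approximate equivariance for more and more group elements with probability tending to one.
  obtain ⟨n, hn, hR, hlift⟩ := IsLift.exists_diagonal hω hF
    (tendstoInMeasure_of_tendsto_ae (fun n => aestronglyMeasurable_of_isLift (hF n))
      (Eventually.of_forall hlim))
    (R := fun n k => ∀ i ∈ Finset.range (n + 1), 1 - ((n : ℝ≥0∞) + 1)⁻¹ <
      (μ n k : Measure (Fin (d k) → X))
        (approxMicrostates σ k (e i) (U n) (1 / ((n : ℝ) + 1))))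
    (fun n => (Filter.eventually_all_finset _).2 fun i _ =>
      (hμ n (e i) (U n) (hUo n) (hUd n) (1 / ((n : ℝ) + 1)) (by positivity)).eventually_const_lt
        (ENNReal.sub_lt_self ENNReal.one_ne_top one_ne_zero (by simp)))
  refine ⟨fun k => μ (n k) k, ?_, isLift_iff_ae_eq_ultralimit.1 hlift⟩
  intro g V hV hVd ε hε
  obtain ⟨i, rfl⟩ := he g
  obtain ⟨N, hN⟩ := hUb V hV hVd
  obtain ⟨M, hM⟩ := exists_nat_one_div_lt hε
  have hto1 : Tendsto (fun n : ℕ => 1 - ((n : ℝ≥0∞) + 1)⁻¹) atTop (𝓝 1) := by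
    have h1 : Tendsto (fun n : ℕ => ((n : ℝ≥0∞) + 1)⁻¹) atTop (𝓝 0) := by
      have := (tendsto_add_atTop_iff_nat 1).2 ENNReal.tendsto_inv_nat_nhds_zero
      simpa using this
    simpa using ENNReal.Tendsto.sub (tendsto_const_nhds (x := (1 : ℝ≥0∞))) h1 (by simp)
  refine tendsto_of_tendsto_of_tendsto_of_le_of_le' (hto1.comp hn) tendsto_const_nhds ?_
    (Eventually.of_forall fun k => prob_le_one)
  filter_upwards [hR, hn.eventually_ge_atTop i, hn.eventually_ge_atTop N,
    hn.eventually_ge_atTop M] with k hk h1 h2 h3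
  exact (hk i (Finset.mem_range.2 (Nat.lt_succ_iff.2 h1))).le.trans (measure_mono
    (approxMicrostates_mono σ k (e i) ((hUa h2).trans hN)
      ((Nat.one_div_le_one_div h3).trans hM.le)))

end RandomMicrostates

/-! ### The greatest local limit and the least absorbing map -/

theorem isLift_const_iff {E : Type*} [TopologicalSpace E] [FirstCountableTopology E]
    {ω : Ultrafilter ℕ} {d : ℕ → ℕ} [∀ k, NeZero (d k)] (hω : ∀ s : Set ℕ, s.Finite → s ∉ ω)
    {f : ∀ k, Fin (d k) → E} {x : E} :
    IsLift ω f (fun _ => x) ↔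
      ∀ O ∈ 𝓝 x, Tendsto (fun k => unif {j | f k j ∈ O}) (ω : Filter ℕ) (𝓝 1) := by
  simp only [← ae_mem_internalSet_iff hω]
  constructor
  · intro h O hO
    filter_upwards [h] with z hz
    obtain ⟨j, rfl⟩ := z.exists_rep
    exact mk_mem_internalSet.2 (hz j rfl hO)
  · intro h
    obtain ⟨O, hO⟩ := (𝓝 x).exists_antitone_basis
    filter_upwards [ae_all_iff.2 fun n => h (O n) (hO.1.mem_of_mem trivial)] with z hz
    rintro j rfl
    exact hO.1.tendsto_right_iff.2 fun n _ => mk_mem_internalSet.1 (hz n)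

section Main

variable {G : Type*} [Group G] [Countable G] {X : Type*} [Group X] [TopologicalSpace X]
  [IsTopologicalGroup X] [CompactSpace X] [TopologicalSpace.MetrizableSpace X]
  [MeasurableSpace X] [BorelSpace X] [MulDistribMulAction G X] [ContinuousConstSMul G X]
  {ω : Ultrafilter ℕ} {d : ℕ → ℕ} [∀ k, NeZero (d k)]
  {σ : ∀ k, G → Equiv.Perm (Fin (d k))}

omit [∀ k, NeZero (d k)] [ContinuousConstSMul G X] [Countable G] in
theorem mem_localLimitSubgroups_iff {Y : MeasSub X ω d} :
    Y ∈ localLimitSubgroups X σ ω ↔ ∃ μ : ∀ k, ProbabilityMeasure (Fin (d k) → X),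
      AsympSupportedOnMicrostates σ ω μ ∧
        IsLift ω (fun k => marginal (μ k)) fun z => subgroupHaar (Y z) := by
  have : Nonempty (ProbabilityMeasure X) := ⟨diracProba 1⟩
  exact exists_congr fun μ => and_congr_right fun _ => isLift_iff_ae_eq_ultralimit.symm

theorem le_of_mem_localLimitSubgroups_of_mem_absorbingSubgroups
    (hω : ∀ s : Set ℕ, s.Finite → s ∉ ω) {Y Y' : MeasSub X ω d}
    (hY : Y ∈ localLimitSubgroups X σ ω) (hY' : Y' ∈ absorbingSubgroups X σ ω) : Y ≤ Y' := by
  obtain ⟨μ, hμ, hm⟩ := mem_localLimitSubgroups_iff.1 hY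
  have h := AbsorbsMicrostates.ae_measure_eq_one hω hμ hm
    (aestronglyMeasurable_subgroupCompacts_iff.2 Y'.aestronglyMeasurable) hY'
  rw [← AEEqFun.coeFn_le]
  filter_upwards [h] with z hz
  exact SetLike.coe_subset_coe.1 (subset_of_subgroupHaar_eq_one (Y' z).isClosed' hz)

theorem exists_mem_localLimitSubgroups_isLeast (hω : ∀ s : Set ℕ, s.Finite → s ∉ ω) :
    ∃ Y : MeasSub X ω d, Y ∈ localLimitSubgroups X σ ω ∧
      IsLeast (absorbingSubgroups X σ ω) Y := by
  have := isProbabilityMeasure_loebMeasure (d := d) hω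
  have hsc : SecondCountableTopology X := by
    let _ := TopologicalSpace.metrizableSpaceMetric X
    infer_instance
  obtain ⟨C, hCS, hCc, hC⟩ := exists_countable_ae_mem_closure
    (μ := loebMeasure ω d) (microstateGroup X σ ω : Set (LoebSpace ω d → X)) fun F hF => hF.1
  have hcount : Countable C := hCc
  -- Actual functions are used rather than a.e. classes, so that evaluation at every `z` is a
  -- homomorphism; `FreeGroup C` is countable.
  let π : FreeGroup C →* (LoebSpace ω d → X) := FreeGroup.lift (↑)
  have hπ : ∀ γ, π γ ∈ microstateGroup X σ ω := fun γ =>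
    FreeGroup.range_lift_le (by rwa [Subtype.range_coe]) ⟨γ, rfl⟩
  have hmeas := aestronglyMeasurable_closedRange (μ := loebMeasure ω d)
    (π := evalHom π) fun γ => (hπ γ).1
  have hY := AEEqFun.coeFn_mk _ hmeas
  refine ⟨AEEqFun.mk _ hmeas, ?_, ?_, ?_⟩
  · obtain ⟨μ, hμ, hm⟩ := isGeneralizedLocalLimit_closedRange hω π hπ
    refine ⟨μ, hμ, EventuallyEq.trans ?_ hm⟩
    filter_upwards [hY] with z hz
    rw [hz]
  · intro Θ hΘ
    filter_upwards [hY, hC _ hΘ.coeFn_mem_microstateGroup] with z h1 h2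
    rw [h1, coe_closedRange]
    refine closure_mono ?_ h2
    rintro _ ⟨F, hF, rfl⟩
    refine ⟨FreeGroup.of ⟨F, hF⟩, ?_⟩
    exact congrFun (FreeGroup.lift_apply_of (f := ((↑) : C → LoebSpace ω d → X)) (x := ⟨F, hF⟩)) z
  · intro Y' hY'
    have hall : ∀ γ, ∀ᵐ z ∂loebMeasure ω d, π γ z ∈ (Y' z : Set X) := fun γ => by
      filter_upwards [hY' _ (isMicrostate_mk hω (hπ γ)), AEEqFun.coeFn_mk _ (hπ γ).1] with z h1 h2
      rwa [h2] at h1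
    rw [← AEEqFun.coeFn_le]
    filter_upwards [hY, ae_all_iff.2 hall] with z h1 h2
    rw [h1, ← SetLike.coe_subset_coe, coe_closedRange]
    refine closure_minimal ?_ (Y' z).isClosed'
    rintro _ ⟨γ, rfl⟩
    exact h2 γ

end Main

end SoficLoeb

theorem theorem1p2
    {G : Type*} [Group G] [Countable G]
    {d : ℕ → ℕ} [∀ k, NeZero (d k)]
    (σ : ∀ k, G → Equiv.Perm (Fin (d k))) (hσ : SoficLoeb.IsSoficApproximation σ)
    (ω : Ultrafilter ℕ) (hω : ∀ s : Set ℕ, s.Finite → s ∉ ω)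
    {X : Type*} [Group X] [TopologicalSpace X] [IsTopologicalGroup X] [CompactSpace X]
    [TopologicalSpace.MetrizableSpace X] [MeasurableSpace X] [BorelSpace X]
    [MulDistribMulAction G X] [ContinuousConstSMul G X] :
    (∃ Y : SoficLoeb.MeasSub X ω d, IsGreatest (SoficLoeb.localLimitSubgroups X σ ω) Y) ∧
    ∀ Y : SoficLoeb.MeasSub X ω d, IsGreatest (SoficLoeb.localLimitSubgroups X σ ω) Y →
      IsLeast (SoficLoeb.absorbingSubgroups X σ ω) Y ∧
      (Y = AEEqFun.const (SoficLoeb.LoebSpace ω d) (SoficLoeb.wholeGroup X) ↔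
        ∃ μ : ∀ k, ProbabilityMeasure (Fin (d k) → X),
          SoficLoeb.AsympSupportedOnMicrostates σ ω μ ∧
          SoficLoeb.LocalWeakStarTendsto ω μ (SoficLoeb.haarProb X)) := by
  have := SoficLoeb.isProbabilityMeasure_loebMeasure (d := d) hω
  obtain ⟨Y₀, hY₀, hY₀least⟩ :=
    SoficLoeb.exists_mem_localLimitSubgroups_isLeast (X := X) (σ := σ) hω
  have hgreatest : IsGreatest (SoficLoeb.localLimitSubgroups X σ ω) Y₀ :=
    ⟨hY₀, fun Y hY =>
      SoficLoeb.le_of_mem_localLimitSubgroups_of_mem_absorbingSubgroups hω hY hY₀least.1⟩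
  refine ⟨⟨Y₀, hgreatest⟩, fun Y hY => ⟨hY.unique hgreatest ▸ hY₀least, ?_⟩⟩
  have hconst := AEEqFun.coeFn_const (SoficLoeb.LoebSpace ω d) (SoficLoeb.wholeGroup X)
    (μ := SoficLoeb.loebMeasure ω d)
  have hwhole : SoficLoeb.LocalWeakStarTendsto ω (X := X) (d := d) = fun μ ν =>
      SoficLoeb.IsLift ω (fun k => SoficLoeb.marginal (μ k)) fun _ => ν :=
    funext₂ fun μ ν => propext (SoficLoeb.isLift_const_iff hω).symm
  have hmem : AEEqFun.const (SoficLoeb.LoebSpace ω d) (SoficLoeb.wholeGroup X) ∈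
      SoficLoeb.localLimitSubgroups X σ ω ↔ ∃ μ : ∀ k, ProbabilityMeasure (Fin (d k) → X),
        SoficLoeb.AsympSupportedOnMicrostates σ ω μ ∧
        SoficLoeb.LocalWeakStarTendsto ω μ (SoficLoeb.haarProb X) := by
    rw [SoficLoeb.mem_localLimitSubgroups_iff, hwhole]
    have heq : (fun z => SoficLoeb.subgroupHaar
        ((AEEqFun.const (SoficLoeb.LoebSpace ω d) (SoficLoeb.wholeGroup X) :
          SoficLoeb.MeasSub X ω d) z))
        =ᵐ[SoficLoeb.loebMeasure ω d] fun _ => SoficLoeb.haarProb X := by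
      filter_upwards [hconst] with z hz
      rw [hz, Function.const_apply, SoficLoeb.subgroupHaar_wholeGroup]
    exact exists_congr fun μ => and_congr_right fun _ =>
      ⟨fun h => h.congr heq, fun h => h.congr heq.symm⟩
  rw [← hmem]
  -- Everything lies below the constant map $X$, so a greatest element equals it as soon as it
  -- belongs to $\mathcal S_\omega$.
  refine ⟨fun h => h ▸ hY.1, fun h => le_antisymm ?_ (hY.2 h)⟩
  rw [← AEEqFun.coeFn_le]
  filter_upwards [hconst] with z hz
  rw [hz]
  exact fun x _ => trivial
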